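/- Let $W=\mathcal S_{n+1}$ be the Coxeter group of type $A_n$, generated by $s_p=(p\;p+1)$, $p\in[n]$, acting on $\mathbb R^{n+1}$ by $\sigma e_i=e_{\sigma(i)}$; write $\alpha_p=e_p-e_{p+1}$ and $\omega_p=\sum_{q\le p}e_q$. Let $Q=(q_1,\dots,q_m)$ be a word in the generators and let $w\in W$. For $X\subseteq[m]$ let $Q_X$ be the subword of $Q$ at the positions in $X$ and $\prod Q_X$ its product. The subword complex $\mathcal{SC}(Q,w)$ has as facets the sets $J\subseteq[m]$ such that $Q_{[m]\setminus J}$ is a reduced expression for $w$; its faces are the subsets of facets. For a facet $J$ and $k\in[m]$ put $$r(J,k)=\prod Q_{\{1,\dots,k-1\}\setminus J}(\alpha_{q_k}),\qquad \omega(J,k)=\prod Q_{\{1,\dots,k-1\}\setminus J}(\omega_{q_k}),\qquad b(J)=-\sum_{k=1}^m\omega(J,k),$$ where $\alpha_{q_k}$, $\omega_{q_k}$ denote $\alpha_p$, $\omega_p$ if $q_k=s_p$. Let $\mathrm{Dem}(Q)=\max_{\le_B}\{\prod Q_X: X\subseteq[m]\}$, where $\le_B$ is the Bruhat order and $\prec_B$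 its cover relation. The brick polyhedron is $$\mathcal B(Q,w)=\mathrm{conv}\{b(J): J\text{ a facet of }\mathcal{SC}(Q,w)\}+\mathrm{cone}\{e_i-e_j : i<j,\ w\prec_B (i\;j)\,w\le_B \mathrm{Dem}(Q)\}.$$ For a face $I$ of $\mathcal{SC}(Q,w)$, the modified brick polyhedron is $$\mathcal B^I(Q,w)=\mathrm{conv}\{b(J): J\text{ a facet},\ I\subseteq J\}+\bigcap_{J\text{ a facet},\ I\subseteq J}\mathrm{cone}\{r(J,j): j\in J\setminus I\}.$$ Let $F$ be a non-empty face of $\mathcal B(Q,w)$ (possibly $\mathcal B(Q,w)$ itself), and let $V_F=\mathrm{span}\{p-q: p,q\in F\}$. Then $F=\mathcal B^I(Q,w)$ for some face $I$ of $\mathcal{SC}(Q,w)$. More explicitly, let $J$ be any facet of $\mathcal{SC}(Q,w)$ with $b(J)\in F$, and let $I=\{j\in J: r(J,j)\notin V_F\}$. Then 1. $F=\mathcal B^I(Q,w)$, and 2. for every facet $J'$ of $\mathcal{SC}(Q,w)$, $I\subseteq J'$ if and only if $b(J')\in F$. -/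

import Mathlib

open scoped Pointwise

noncomputable section

namespace BrickPolyhedra

/-! ## The Coxeter group of type `A_n`

`W` is the group of permutations of the `n + 1` points `Fin (n + 1)`; its simple generators are
indexed by `Fin n`. -/

/-- The simple transposition `s_p = (p, p + 1)`. -/
def simpleTransposition {n : ℕ} (p : Fin n) : Equiv.Perm (Fin (n + 1)) :=
  Equiv.swap p.castSucc p.succ

/-- The product in `W` of a word in the generators. -/
def wordProd {n : ℕ} (l : List (Fin n)) : Equiv.Perm (Fin (n + 1)) :=
  (l.map simpleTransposition).prod

/-- The Coxeter length: the smallest length of a word in the generators with product `w`. -/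
def coxeterLength {n : ℕ} (w : Equiv.Perm (Fin (n + 1))) : ℕ :=
  sInf {k : ℕ | ∃ l : List (Fin n), wordProd l = w ∧ l.length = k}

/-- `l` is a reduced expression for `w`: its product is `w` and no word with product `w` is
shorter. -/
def IsReducedExpression {n : ℕ} (l : List (Fin n)) (w : Equiv.Perm (Fin (n + 1))) : Prop :=
  wordProd l = w ∧ ∀ l' : List (Fin n), wordProd l' = w → l.length ≤ l'.length

/-- One step up in the Bruhat order: left multiplication by a reflection (a transposition)
that increases the length. -/
def BruhatStep {n : ℕ} (u v : Equiv.Perm (Fin (n + 1))) : Prop :=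
  ∃ t : Equiv.Perm (Fin (n + 1)), t.IsSwap ∧ v = t * u ∧ coxeterLength u < coxeterLength v

/-- The Bruhat order `u ≤_B v`. -/
def BruhatLE {n : ℕ} (u v : Equiv.Perm (Fin (n + 1))) : Prop :=
  Relation.ReflTransGen BruhatStep u v

/-- The strict Bruhat order `u <_B v`. -/
def BruhatLT {n : ℕ} (u v : Equiv.Perm (Fin (n + 1))) : Prop :=
  BruhatLE u v ∧ u ≠ v

/-- The cover relation `u ≺_B v` of the Bruhat order. -/
def BruhatCovers {n : ℕ} (u v : Equiv.Perm (Fin (n + 1))) : Prop :=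
  BruhatLT u v ∧ ¬ ∃ x : Equiv.Perm (Fin (n + 1)), BruhatLT u x ∧ BruhatLT x v

/-- The action of `W` on `ℝ^{n+1}` by permuting coordinates, with `σ e_i = e_{σ i}`. -/
def permAct {n : ℕ} (σ : Equiv.Perm (Fin (n + 1))) (x : Fin (n + 1) → ℝ) : Fin (n + 1) → ℝ :=
  fun i => x (σ⁻¹ i)

/-- The root `e_i - e_j`; it is positive if `i < j`, and its reflection is the
transposition `(i, j)`. -/
def root {n : ℕ} (i j : Fin (n + 1)) : Fin (n + 1) → ℝ :=
  Pi.single i 1 - Pi.single j 1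

/-- The simple root `α_p = e_p - e_{p+1}`. -/
def simpleRoot {n : ℕ} (p : Fin n) : Fin (n + 1) → ℝ :=
  root p.castSucc p.succ

/-- The fundamental weight `ω_p = ∑_{q ≤ p} e_q`. -/
def fundamentalWeight {n : ℕ} (p : Fin n) : Fin (n + 1) → ℝ :=
  ∑ q ∈ Finset.univ.filter (fun q : Fin (n + 1) => q ≤ p.castSucc), Pi.single q 1

/-! ## Subword complexes

A word `Q = (q_1, …, q_m)` in the generators is a function `Q : Fin m → Fin n`. -/

/-- The subword `Q_X` of `Q` with positions in `X`, read from left to right. -/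
def subword {n m : ℕ} (Q : Fin m → Fin n) (X : Finset (Fin m)) : List (Fin n) :=
  ((List.finRange m).filter (fun k => k ∈ X)).map Q

/-- `I` is a facet of the subword complex of `Q` and `w`: the letters at the positions outside
`I` form a reduced expression for `w`. -/
def IsFacet {n m : ℕ} (Q : Fin m → Fin n) (w : Equiv.Perm (Fin (n + 1)))
    (I : Finset (Fin m)) : Prop :=
  IsReducedExpression (subword Q Iᶜ) w

/-- `I` is a face of the subword complex: it is contained in a facet. -/
def IsFace {n m : ℕ} (Q : Fin m → Fin n) (w : Equiv.Perm (Fin (n + 1)))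
    (I : Finset (Fin m)) : Prop :=
  ∃ J : Finset (Fin m), IsFacet Q w J ∧ I ⊆ J

/-- The product `∏ Q_{{1, …, k-1} ∖ I}`. -/
def prefixProd {n m : ℕ} (Q : Fin m → Fin n) (I : Finset (Fin m)) (k : Fin m) :
    Equiv.Perm (Fin (n + 1)) :=
  wordProd (subword Q (Finset.univ.filter (fun i => i < k ∧ i ∉ I)))

/-- The root function `r(I, k) = ∏ Q_{{1, …, k-1} ∖ I} (α_{q_k})`. -/
def rootFunction {n m : ℕ} (Q : Fin m → Fin n) (I : Finset (Fin m)) (k : Fin m) :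
    Fin (n + 1) → ℝ :=
  permAct (prefixProd Q I k) (simpleRoot (Q k))

/-- The weight function `ω(I, k) = ∏ Q_{{1, …, k-1} ∖ I} (ω_{q_k})`. -/
def weightFunction {n m : ℕ} (Q : Fin m → Fin n) (I : Finset (Fin m)) (k : Fin m) :
    Fin (n + 1) → ℝ :=
  permAct (prefixProd Q I k) (fundamentalWeight (Q k))

/-- The brick vector `b(I) = -∑_k ω(I, k)`. -/
def brickVector {n m : ℕ} (Q : Fin m → Fin n) (I : Finset (Fin m)) : Fin (n + 1) → ℝ :=
  -∑ k : Fin m, weightFunction Q I k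

/-! ## Brick polyhedra -/

/-- `d` is the maximum, in the Bruhat order, of the products of all subwords of `Q`. -/
def IsDemazureProduct {n m : ℕ} (Q : Fin m → Fin n) (d : Equiv.Perm (Fin (n + 1))) : Prop :=
  (∃ X : Finset (Fin m), wordProd (subword Q X) = d) ∧
    ∀ X : Finset (Fin m), BruhatLE (wordProd (subword Q X)) d

/-- The Demazure product `Dem(Q) = max_{≤_B} {∏ Q_X | X ⊆ [m]}`. (This maximum always exists,
and it is unique.) -/
def demazureProduct {n m : ℕ} (Q : Fin m → Fin n) : Equiv.Perm (Fin (n + 1)) :=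
  Classical.epsilon (IsDemazureProduct Q)

/-- The Bruhat cone: the cone of the positive roots `β` with `w ≺_B s_β w ≤_B Dem(Q)`. -/
def bruhatCone {n m : ℕ} (Q : Fin m → Fin n) (w : Equiv.Perm (Fin (n + 1))) :
    Set (Fin (n + 1) → ℝ) :=
  (PointedCone.hull ℝ {β : Fin (n + 1) → ℝ | ∃ i j : Fin (n + 1), i < j ∧ β = root i j ∧
    BruhatCovers w (Equiv.swap i j * w) ∧
    BruhatLE (Equiv.swap i j * w) (demazureProduct Q)} : Set (Fin (n + 1) → ℝ))

/-- The brick polyhedron `B(Q, w)`. -/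
def brickPolyhedron {n m : ℕ} (Q : Fin m → Fin n) (w : Equiv.Perm (Fin (n + 1))) :
    Set (Fin (n + 1) → ℝ) :=
  convexHull ℝ {b | ∃ J : Finset (Fin m), IsFacet Q w J ∧ b = brickVector Q J} + bruhatCone Q w

/-- The modified root configuration `R^I(J) = {r(J, j) | j ∈ J ∖ I}`. -/
def modifiedRootConfiguration {n m : ℕ} (Q : Fin m → Fin n) (I J : Finset (Fin m)) :
    Set (Fin (n + 1) → ℝ) :=
  {β | ∃ j ∈ J \ I, β = rootFunction Q J j}

/-- The modified Bruhat cone: the intersection of the cones of `R^I(J)` over all facets `J`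
that contain `I`. -/
def modifiedBruhatCone {n m : ℕ} (Q : Fin m → Fin n) (w : Equiv.Perm (Fin (n + 1)))
    (I : Finset (Fin m)) : Set (Fin (n + 1) → ℝ) :=
  {x | ∀ J : Finset (Fin m), IsFacet Q w J → I ⊆ J →
    x ∈ PointedCone.hull ℝ (modifiedRootConfiguration Q I J)}

/-- The modified brick polyhedron `B^I(Q, w)`. -/
def modifiedBrickPolyhedron {n m : ℕ} (Q : Fin m → Fin n) (w : Equiv.Perm (Fin (n + 1)))
    (I : Finset (Fin m)) : Set (Fin (n + 1) → ℝ) :=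
  convexHull ℝ {b | ∃ J : Finset (Fin m), IsFacet Q w J ∧ I ⊆ J ∧ b = brickVector Q J} +
    modifiedBruhatCone Q w I

/-- A face of a polyhedron `P`: a non-empty subset on which some linear functional attains its
maximum over `P` (the zero functional gives `P` itself). -/
def IsPolyhedronFace {n : ℕ} (P F : Set (Fin (n + 1) → ℝ)) : Prop :=
  F.Nonempty ∧ IsExposed ℝ P F

/-- The direction space `V_F = span {p - q | p, q ∈ F}`. -/
def directionSpace {n : ℕ} (F : Set (Fin (n + 1) → ℝ)) : Submodule ℝ (Fin (n + 1) → ℝ) :=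
  Submodule.span ℝ {v | ∃ p ∈ F, ∃ q ∈ F, v = p - q}

open scoped Classical in
/-- The set `J ∖ J^F` of the `j ∈ J` with `r(J, j) ∉ V_F`. -/
def nonDirectionPositions {n m : ℕ} (Q : Fin m → Fin n) (F : Set (Fin (n + 1) → ℝ))
    (J : Finset (Fin m)) : Finset (Fin m) :=
  J.filter (fun j => rootFunction Q J j ∉ directionSpace F)

end BrickPolyhedra

end

noncomputable section

namespace BrickPolyhedra

/-! ## Simple transpositions and inversions -/

section Inversions

variable {n : ℕ}

/-! Let a linear functional `f` expose `F`. Fix `I`, and call a facet `J ⊇ I` locally optimal if `f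
≤ 0` on its roots at the positions in `J ∖ I`. The core is that local optimality is global, and even
holds position by position: among the facets containing `I`, a locally optimal one minimizes `f` on
every single weight `ω(J, k)` (`wsum_le_of_locOpt`), hence maximizes `f` on brick vectors. Appending
letters until `w` is the longest element makes every root flippable, and a lexicographic
perturbation makes `f` injective on the coordinate vectors. Then the locally optimal facet is unique
(`eq_of_locOpt`). A facet minimizing one chosen weight, with ties broken by the total, is locally
optimal, because a flip changes each weight either by nothing or by minus the flipped root.

If another facet gives the same brick value as a locally optimal one, all weights must agree under
`f`, so all prefixes agree after `f`. The two root functions then have the same `f`-values, and each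
position of the optimal facet with nonzero value lies in the other facet
(`IsFacet.rootFunction_eq_of_le`). Hence every facet on `F` contains `I = {j ∈ J : f (r(J, j)) ≠
0}`. Conversely, relative to this `I` the facet `J` is locally optimal for both `f` and `-f`, so `f`
is constant on the facets containing `I`.

For the cones, `LocOpt.le_of_bruhatCovers` and Farkas' lemma put the Bruhat cone inside the root
cone of every facet. Conversely, each root of a facet is flippable or a cover root
(`IsFacet.flip_or_mem_coverRoots`), so a functional nonpositive on cover roots is nonpositive on the
relevant roots of a facet that maximizes it; this puts the modified Bruhat cone inside the Bruhat
cone. Restricting to `f = 0` gives `IsFacet.levelFace_eq`. -/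

@[simp] lemma simpleTransposition_castSucc (p : Fin n) :
    simpleTransposition p p.castSucc = p.succ := Equiv.swap_apply_left _ _

@[simp] lemma simpleTransposition_succ (p : Fin n) :
    simpleTransposition p p.succ = p.castSucc := Equiv.swap_apply_right _ _

@[simp] lemma simpleTransposition_inv (p : Fin n) :
    (simpleTransposition p)⁻¹ = simpleTransposition p := Equiv.swap_inv _ _

@[simp] lemma simpleTransposition_mul_self (p : Fin n) :
    simpleTransposition p * simpleTransposition p = 1 := Equiv.swap_mul_self _ _

lemma simpleTransposition_lt_iff (p : Fin n) {x y : Fin (n + 1)}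
    (h : ¬ (x = p.castSucc ∧ y = p.succ)) (h' : ¬ (x = p.succ ∧ y = p.castSucc)) :
    simpleTransposition p x < simpleTransposition p y ↔ x < y := by
  unfold simpleTransposition
  simp only [Equiv.swap_apply_def, Fin.ext_iff, Fin.lt_def, Fin.val_castSucc, Fin.val_succ] at *
  split_ifs <;> simp only [Fin.val_castSucc, Fin.val_succ] <;> omega

/-- The inversions of `u`, as pairs of values `a < b` such that `b` stands before `a`. -/
def inversions (u : Equiv.Perm (Fin (n + 1))) : Finset (Fin (n + 1) × Fin (n + 1)) :=
  Finset.univ.filter (fun x => x.1 < x.2 ∧ u⁻¹ x.2 < u⁻¹ x.1)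

lemma mem_inversions {u : Equiv.Perm (Fin (n + 1))} {a b : Fin (n + 1)} :
    (a, b) ∈ inversions u ↔ a < b ∧ u⁻¹ b < u⁻¹ a := by
  simp [inversions]

@[simp] lemma inversions_one : inversions (1 : Equiv.Perm (Fin (n + 1))) = ∅ := by
  ext ⟨a, b⟩
  simp only [mem_inversions, inv_one, Equiv.Perm.coe_one, id_eq, Finset.notMem_empty, iff_false]
  rintro ⟨h, h'⟩
  exact absurd h h'.asymm

/-- Right multiplication by `s_p` changes only the order of the values at `p` and `p + 1`. -/
lemma mul_simpleTransposition_lt_iff (u : Equiv.Perm (Fin (n + 1))) (p : Fin n)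
    {a b : Fin (n + 1)} (h : ¬ (a = u p.castSucc ∧ b = u p.succ))
    (h' : ¬ (a = u p.succ ∧ b = u p.castSucc)) :
    (u * simpleTransposition p)⁻¹ a < (u * simpleTransposition p)⁻¹ b ↔ u⁻¹ a < u⁻¹ b := by
  rw [mul_inv_rev, simpleTransposition_inv, Equiv.Perm.mul_apply, Equiv.Perm.mul_apply]
  apply simpleTransposition_lt_iff
  · rwa [Equiv.Perm.inv_eq_iff_eq, Equiv.Perm.inv_eq_iff_eq]
  · rwa [Equiv.Perm.inv_eq_iff_eq, Equiv.Perm.inv_eq_iff_eq]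

lemma mul_simpleTransposition_inv_lower (u : Equiv.Perm (Fin (n + 1))) (p : Fin n) :
    (u * simpleTransposition p)⁻¹ (u p.succ) = p.castSucc := by
  simp [mul_inv_rev]

lemma mul_simpleTransposition_inv_upper (u : Equiv.Perm (Fin (n + 1))) (p : Fin n) :
    (u * simpleTransposition p)⁻¹ (u p.castSucc) = p.succ := by
  simp [mul_inv_rev]

/-- The generator exchanges two adjacent positions, so only the two values there change their
relative order. All length computations rest on this. -/
lemma inversions_mul_simpleTransposition {u : Equiv.Perm (Fin (n + 1))} {p : Fin n}
    (h : u p.castSucc < u p.succ) :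
    inversions (u * simpleTransposition p) =
        insert (u p.castSucc, u p.succ) (inversions u) ∧
      (u p.castSucc, u p.succ) ∉ inversions u := by
  constructor
  · ext ⟨a, b⟩
    rw [Finset.mem_insert, mem_inversions, mem_inversions, Prod.mk.injEq]
    by_cases h1 : a = u p.castSucc ∧ b = u p.succ
    · obtain ⟨rfl, rfl⟩ := h1
      simp [h]
    by_cases h2 : a = u p.succ ∧ b = u p.castSucc
    · obtain ⟨rfl, rfl⟩ := h2
      simp [h.not_gt, h.ne']
    rw [mul_simpleTransposition_lt_iff u p (fun h => h2 h.symm) (fun h => h1 h.symm)]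
    simp only [h1, false_or]
  · rw [mem_inversions, Equiv.Perm.inv_def, Equiv.symm_apply_apply, Equiv.symm_apply_apply]
    exact fun h => h.2.asymm Fin.castSucc_lt_succ

lemma card_inversions_mul_of_lt {u : Equiv.Perm (Fin (n + 1))} {p : Fin n}
    (h : u p.castSucc < u p.succ) :
    (inversions (u * simpleTransposition p)).card = (inversions u).card + 1 := by
  obtain ⟨h1, h2⟩ := inversions_mul_simpleTransposition h
  rw [h1, Finset.card_insert_of_notMem h2]

lemma card_inversions_mul_of_gt {u : Equiv.Perm (Fin (n + 1))} {p : Fin n}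
    (h : u p.succ < u p.castSucc) :
    (inversions (u * simpleTransposition p)).card + 1 = (inversions u).card := by
  have := card_inversions_mul_of_lt (u := u * simpleTransposition p) (p := p) (by simpa using h)
  rw [mul_assoc, simpleTransposition_mul_self, mul_one] at this
  exact this.symm

lemma apply_castSucc_lt_or_gt (u : Equiv.Perm (Fin (n + 1))) (p : Fin n) :
    u p.castSucc < u p.succ ∨ u p.succ < u p.castSucc := by
  apply lt_or_gt_of_ne
  simp [Fin.ext_iff]

lemma eq_one_of_forall_lt {u : Equiv.Perm (Fin (n + 1))}
    (h : ∀ p : Fin n, u p.castSucc < u p.succ) : u = 1 := by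
  have hm : StrictMono u := Fin.strictMono_iff_lt_succ.2 h
  ext x
  have := Subsingleton.elim (hm.orderIsoOfSurjective u u.surjective) (OrderIso.refl _)
  have := congrArg (fun e => e x) this
  simpa using congrArg Fin.val this

/-! ### Length as the number of inversions. -/

lemma wordProd_append_singleton (l : List (Fin n)) (p : Fin n) :
    wordProd (l ++ [p]) = wordProd l * simpleTransposition p := by
  simp [wordProd]

lemma card_inversions_wordProd_le (l : List (Fin n)) :
    (inversions (wordProd l)).card ≤ l.length := by
  induction l using List.reverseRecOn with
  | nil => simp [wordProd]
  | append_singleton l p ih =>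
    rw [wordProd_append_singleton, List.length_append, List.length_singleton]
    rcases apply_castSucc_lt_or_gt (wordProd l) p with h | h
    · rw [card_inversions_mul_of_lt h]; omega
    · have := card_inversions_mul_of_gt h; omega

/-- A permutation other than the identity has a descent, and removing it costs exactly one
inversion. With the preceding bound this lets the inversion count replace the Coxeter length. -/
lemma exists_wordProd_eq (u : Equiv.Perm (Fin (n + 1))) :
    ∃ l : List (Fin n), wordProd l = u ∧ l.length = (inversions u).card := by
  induction hk : (inversions u).card generalizing u with
  | zero =>
    refine ⟨[], ?_, rfl⟩
    rw [eq_one_of_forall_lt (u := u)]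
    · rfl
    · intro p
      refine (apply_castSucc_lt_or_gt u p).resolve_right fun h => ?_
      have := card_inversions_mul_of_gt h; omega
  | succ k ih =>
    have : ∃ p : Fin n, u p.succ < u p.castSucc := by
      by_contra! hcon
      have : u = 1 := eq_one_of_forall_lt fun p =>
        (apply_castSucc_lt_or_gt u p).resolve_right (hcon p).not_gt
      simp [this] at hk
    obtain ⟨p, hp⟩ := this
    have := card_inversions_mul_of_gt hp
    obtain ⟨l, hl, hlk⟩ := ih (u * simpleTransposition p) (by omega)
    refine ⟨l ++ [p], ?_, by simp [hlk]⟩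
    rw [wordProd_append_singleton, hl, mul_assoc, simpleTransposition_mul_self, mul_one]

lemma coxeterLength_eq (u : Equiv.Perm (Fin (n + 1))) :
    coxeterLength u = (inversions u).card := by
  obtain ⟨l, hl, hlk⟩ := exists_wordProd_eq u
  apply le_antisymm
  · exact Nat.sInf_le ⟨l, hl, hlk⟩
  · refine le_csInf ⟨_, l, hl, rfl⟩ ?_
    rintro k ⟨l', rfl, rfl⟩
    exact card_inversions_wordProd_le l'

lemma isReducedExpression_iff {l : List (Fin n)} {u : Equiv.Perm (Fin (n + 1))} :
    IsReducedExpression l u ↔ wordProd l = u ∧ l.length = (inversions u).card := by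
  constructor
  · rintro ⟨rfl, h⟩
    obtain ⟨l', hl', hlk⟩ := exists_wordProd_eq (wordProd l)
    exact ⟨rfl, le_antisymm (hlk ▸ h l' hl') (card_inversions_wordProd_le l)⟩
  · rintro ⟨rfl, h⟩
    refine ⟨rfl, fun l' hl' => ?_⟩
    rw [h, ← hl']
    exact card_inversions_wordProd_le l'

end Inversions

/-! ## Prefixes of subwords

A word is the restriction of `Q : ℕ → Fin n` to the positions below `m`; `J` is the set of
omitted positions. -/

section Prefixes

variable {n : ℕ}

/-- The product of the letters of `Q` at the positions below `k` outside `J`. -/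
def pre (Q : ℕ → Fin n) (J : Finset ℕ) : ℕ → Equiv.Perm (Fin (n + 1))
  | 0 => 1
  | k + 1 => if k ∈ J then pre Q J k else pre Q J k * simpleTransposition (Q k)

/-- The root at the position `k` is `e_{upper} - e_{lower}`. -/
def upper (Q : ℕ → Fin n) (J : Finset ℕ) (k : ℕ) : Fin (n + 1) := pre Q J k (Q k).castSucc

/-- The root at the position `k` is `e_{upper} - e_{lower}`. -/
def lower (Q : ℕ → Fin n) (J : Finset ℕ) (k : ℕ) : Fin (n + 1) := pre Q J k (Q k).succ

/-- The value `a` stands before the value `b` in `u`. -/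
def Above (u : Equiv.Perm (Fin (n + 1))) (a b : Fin (n + 1)) : Prop := u⁻¹ a < u⁻¹ b

variable {Q : ℕ → Fin n} {J J' : Finset ℕ} {k l m : ℕ} {w : Equiv.Perm (Fin (n + 1))}

@[simp] lemma pre_zero : pre Q J 0 = 1 := rfl

lemma pre_succ_of_mem (h : k ∈ J) : pre Q J (k + 1) = pre Q J k := by simp [pre, h]

lemma pre_succ_of_notMem (h : k ∉ J) :
    pre Q J (k + 1) = pre Q J k * simpleTransposition (Q k) := by simp [pre, h]

lemma upper_ne_lower : upper Q J k ≠ lower Q J k := by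
  simp [upper, lower, Fin.ext_iff]

lemma above_upper_lower : Above (pre Q J k) (upper Q J k) (lower Q J k) := by
  simp [Above, upper, lower, Fin.lt_def]

lemma above_lower_upper_succ (h : k ∉ J) :
    Above (pre Q J (k + 1)) (lower Q J k) (upper Q J k) := by
  rw [pre_succ_of_notMem h, Above, lower, upper, mul_simpleTransposition_inv_lower,
    mul_simpleTransposition_inv_upper]
  simp [Fin.lt_def]

lemma above_or_above (u : Equiv.Perm (Fin (n + 1))) {a b : Fin (n + 1)} (h : a ≠ b) :
    Above u a b ∨ Above u b a :=
  lt_or_gt_of_ne fun h' => h (u⁻¹.injective h')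

lemma Above.asymm {u : Equiv.Perm (Fin (n + 1))} {a b : Fin (n + 1)} (h : Above u a b) :
    ¬ Above u b a := lt_asymm h

lemma Above.ne {u : Equiv.Perm (Fin (n + 1))} {a b : Fin (n + 1)} (h : Above u a b) :
    a ≠ b := by
  rintro rfl; exact lt_irrefl _ h

lemma Above.trans {u : Equiv.Perm (Fin (n + 1))} {a b c : Fin (n + 1)} (h : Above u a b)
    (h' : Above u b c) : Above u a c := lt_trans h h'

/-- The order of two values changes from one prefix to the next only at a crossing of them. -/
lemma crossing_of_above {a b : Fin (n + 1)} (h : Above (pre Q J k) a b)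
    (h' : Above (pre Q J (k + 1)) b a) : k ∉ J ∧ upper Q J k = a ∧ lower Q J k = b := by
  by_cases hk : k ∈ J
  · rw [pre_succ_of_mem hk] at h'
    exact absurd h' h.asymm
  refine ⟨hk, ?_⟩
  by_contra hcon
  rw [pre_succ_of_notMem hk] at h'
  by_cases h2 : b = upper Q J k ∧ a = lower Q J k
  · rw [h2.1, h2.2] at h
    exact h.asymm above_upper_lower
  · exact h.asymm ((mul_simpleTransposition_lt_iff _ _ h2
      (fun h3 => hcon ⟨h3.2.symm, h3.1.symm⟩)).1 h')

/-- The order of the two values is opposite at the two ends, so it switches at some step, and only a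
crossing of these very values can switch it. -/
lemma exists_crossing_between {a b : Fin (n + 1)} {k₀ : ℕ} (h : Above (pre Q J k₀) a b)
    (hk : k₀ ≤ m) (h' : Above (pre Q J m) b a) :
    ∃ k, k₀ ≤ k ∧ k < m ∧ k ∉ J ∧ upper Q J k = a ∧ lower Q J k = b := by
  induction m, hk using Nat.le_induction with
  | base => exact absurd h' h.asymm
  | succ m hk ih =>
    rcases above_or_above (pre Q J m) h.ne with h1 | h1
    · exact ⟨m, hk, by omega, crossing_of_above h1 h'⟩
    · obtain ⟨k, h2, h3, h4⟩ := ih h1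
      exact ⟨k, h2, by omega, h4⟩

lemma exists_crossing {a b : Fin (n + 1)} (hab : a < b) (h : Above (pre Q J m) b a) :
    ∃ k, k < m ∧ k ∉ J ∧ upper Q J k = a ∧ lower Q J k = b := by
  obtain ⟨k, -, hk⟩ := exists_crossing_between (k₀ := 0) (by simpa [Above] using hab)
    (Nat.zero_le m) h
  exact ⟨k, hk⟩

/-- Toggling the letter at the position `x` multiplies the later prefixes by a transposition. -/
lemma pre_toggle {x : ℕ} (hJ : ∀ i, i ≠ x → (i ∈ J' ↔ i ∈ J)) (hx : x ∈ J' ↔ x ∉ J) (l : ℕ) :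
    pre Q J' l = if l ≤ x then pre Q J l
      else Equiv.swap (upper Q J x) (lower Q J x) * pre Q J l := by
  induction l with
  | zero => simp
  | succ l ih =>
    rcases lt_trichotomy l x with h | rfl | h
    · rw [if_pos h.le] at ih
      simp [pre, ih, hJ l h.ne, Nat.succ_le_of_lt h]
    · rw [if_pos le_rfl] at ih
      rw [if_neg (by omega)]
      have hs : Equiv.swap (upper Q J l) (lower Q J l) * pre Q J l =
          pre Q J l * simpleTransposition (Q l) := by
        rw [upper, lower, simpleTransposition, Equiv.swap_apply_apply]
        simp [mul_assoc]
      by_cases hl : l ∈ J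
      · rw [pre_succ_of_notMem (by simpa [hx] using hl), pre_succ_of_mem hl, ih, hs]
      · rw [pre_succ_of_mem (by simpa [hx] using hl), pre_succ_of_notMem hl, ih, ← mul_assoc, hs,
          mul_assoc, simpleTransposition_mul_self, mul_one]
    · rw [if_neg (by omega)] at ih
      rw [if_neg (by omega)]
      simp only [pre, ih, hJ l h.ne']
      split_ifs <;> simp [mul_assoc]

/-- Toggling two letters with the same root up to sign multiplies the prefixes in between by a
transposition. -/
lemma pre_toggle_toggle {x y : ℕ} (hxy : x < y)
    (hJ : ∀ i, i ≠ x → i ≠ y → (i ∈ J' ↔ i ∈ J)) (hx : x ∈ J' ↔ x ∉ J) (hy : y ∈ J' ↔ y ∉ J)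
    (hroot : (upper Q J y = upper Q J x ∧ lower Q J y = lower Q J x) ∨
      (upper Q J y = lower Q J x ∧ lower Q J y = upper Q J x)) (l : ℕ) :
    pre Q J' l = if x < l ∧ l ≤ y then Equiv.swap (upper Q J x) (lower Q J x) * pre Q J l
      else pre Q J l := by
  -- Toggle `x` alone first. This reflects the root at `y` in the root at `x`, which fixes the
  -- unordered pair; the second toggle thus contributes the same transposition, and the two cancel
  -- after `y`.
  obtain ⟨K, hK, hKx⟩ : ∃ K : Finset ℕ, (∀ i, i ≠ x → (i ∈ K ↔ i ∈ J)) ∧ (x ∈ K ↔ x ∉ J) := by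
    by_cases h : x ∈ J
    · exact ⟨J.erase x, fun i hi => by simp [hi], by simp [h]⟩
    · exact ⟨insert x J, fun i hi => by simp [hi], by simp [h]⟩
  have h1 := pre_toggle (Q := Q) hK hKx
  have h2 := pre_toggle (Q := Q) (J := K) (J' := J') (x := y) (fun i hi => by
    by_cases hix : i = x
    · subst hix; rw [hx, hKx]
    · rw [hJ i hix hi, hK i hix]) (by rw [hy, hK y hxy.ne']) l
  have hu : upper Q K y = Equiv.swap (upper Q J x) (lower Q J x) (upper Q J y) := by
    rw [upper, h1, if_neg (by omega)]; rfl
  have hl : lower Q K y = Equiv.swap (upper Q J x) (lower Q J x) (lower Q J y) := by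
    rw [lower, h1, if_neg (by omega)]; rfl
  have hsw : Equiv.swap (upper Q K y) (lower Q K y) =
      Equiv.swap (upper Q J x) (lower Q J x) := by
    rw [hu, hl]
    rcases hroot with ⟨h3, h4⟩ | ⟨h3, h4⟩ <;> rw [h3, h4] <;>
      simp [Equiv.swap_comm]
  rw [h2, hsw, h1 l]
  by_cases hlx : l ≤ x
  · rw [if_pos (by omega), if_pos hlx, if_neg (by omega)]
  by_cases hly : l ≤ y
  · rw [if_pos hly, if_neg hlx, if_pos (by omega)]
  · rw [if_neg hly, if_neg hlx, if_neg (by omega), ← mul_assoc, Equiv.swap_mul_self, one_mul]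

/-! ## Facets -/

/-- `J` is a facet of the subword complex of the first `m` letters of `Q` and `w`. -/
structure FacetN (Q : ℕ → Fin n) (m : ℕ) (w : Equiv.Perm (Fin (n + 1))) (J : Finset ℕ) :
    Prop where
  subset : J ⊆ Finset.range m
  pre_eq : pre Q J m = w
  card_eq : (Finset.range m \ J).card = (inversions w).card

lemma card_range_succ_sdiff_of_mem (h : k ∈ J) :
    (Finset.range (k + 1) \ J).card = (Finset.range k \ J).card := by
  rw [Finset.range_add_one, Finset.insert_sdiff_of_mem _ h]

lemma card_range_succ_sdiff_of_notMem (h : k ∉ J) :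
    (Finset.range (k + 1) \ J).card = (Finset.range k \ J).card + 1 := by
  rw [Finset.range_add_one, Finset.insert_sdiff_of_notMem _ h, Finset.card_insert_of_notMem]
  simp

/-- Each used letter changes the inversion count by `+1` or `-1` according to the sign of its root,
so a word is reduced exactly when all its used roots are positive. -/
lemma card_inversions_pre (Q : ℕ → Fin n) (J : Finset ℕ) (m : ℕ) :
    (inversions (pre Q J m)).card ≤ (Finset.range m \ J).card ∧
      ((inversions (pre Q J m)).card = (Finset.range m \ J).card ↔
        ∀ k < m, k ∉ J → upper Q J k < lower Q J k) := by
  induction m with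
  | zero => simp
  | succ m ih =>
    by_cases hm : m ∈ J
    · rw [card_range_succ_sdiff_of_mem hm, pre_succ_of_mem hm]
      refine ⟨ih.1, ih.2.trans ⟨fun h k hk hkJ => h k ?_ hkJ, fun h k hk => h k (by omega)⟩⟩
      have : k ≠ m := by rintro rfl; exact hkJ hm
      omega
    · rw [card_range_succ_sdiff_of_notMem hm, pre_succ_of_notMem hm]
      rcases apply_castSucc_lt_or_gt (pre Q J m) (Q m) with h | h
      · rw [card_inversions_mul_of_lt h]
        rw [add_left_inj, ih.2]
        refine ⟨by omega, fun h' k hk hkJ => ?_, fun h' k hk => h' k (by omega)⟩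
        rcases Nat.lt_succ_iff_lt_or_eq.1 hk with h1 | rfl
        · exact h' k h1 hkJ
        · exact h
      · have := card_inversions_mul_of_gt h
        refine ⟨by omega, ⟨fun h' => by omega, fun h' => ?_⟩⟩
        exact absurd (h' m (by omega) hm) h.not_gt

lemma FacetN.upper_lt_lower (hJ : FacetN Q m w J) (hk : k < m) (hkJ : k ∉ J) :
    upper Q J k < lower Q J k := by
  refine (card_inversions_pre Q J m).2.1 ?_ k hk hkJ
  rw [hJ.pre_eq, hJ.card_eq]

lemma facetN_of_upper_lt_lower (hs : J ⊆ Finset.range m) (hw : pre Q J m = w)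
    (h : ∀ k < m, k ∉ J → upper Q J k < lower Q J k) : FacetN Q m w J := by
  refine ⟨hs, hw, ?_⟩
  rw [← (card_inversions_pre Q J m).2.2 h, hw]

/-- Inversions of a prefix of a reduced word remain inversions. -/
lemma FacetN.above_mono (hJ : FacetN Q m w J) {a b : Fin (n + 1)} (hab : a < b) (hkl : k ≤ l)
    (hl : l ≤ m) (h : Above (pre Q J k) b a) : Above (pre Q J l) b a := by
  refine (above_or_above _ hab.ne).resolve_left fun h' => ?_
  obtain ⟨i, -, hi, hiJ, h1, h2⟩ := exists_crossing_between h hkl h'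
  have := hJ.upper_lt_lower (by omega) hiJ
  rw [h1, h2] at this
  exact this.asymm hab

lemma FacetN.above_of_le_crossing (hJ : FacetN Q m w J) (hk : k < m) (hkJ : k ∉ J) (hl : l ≤ k) :
    Above (pre Q J l) (upper Q J k) (lower Q J k) := by
  refine (above_or_above _ upper_ne_lower).resolve_right fun h => ?_
  exact above_upper_lower.asymm (hJ.above_mono (hJ.upper_lt_lower hk hkJ) hl hk.le h)

lemma FacetN.above_of_crossing_lt (hJ : FacetN Q m w J) (hk : k < m) (hkJ : k ∉ J) (hl : k < l)
    (hlm : l ≤ m) : Above (pre Q J l) (lower Q J k) (upper Q J k) :=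
  hJ.above_mono (hJ.upper_lt_lower hk hkJ) hl hlm (above_lower_upper_succ hkJ)

/-- The pair of values at `k`, up to order. -/
def IsPairAt (Q : ℕ → Fin n) (J : Finset ℕ) (k : ℕ) (a b : Fin (n + 1)) : Prop :=
  (upper Q J k = a ∧ lower Q J k = b) ∨ (upper Q J k = b ∧ lower Q J k = a)

lemma IsPairAt.symm {a b : Fin (n + 1)} (h : IsPairAt Q J k a b) : IsPairAt Q J k b a := Or.symm h

/-- The two values are inverted by `w`. -/
def Inverted (w : Equiv.Perm (Fin (n + 1))) (c d : Fin (n + 1)) : Prop :=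
  (c < d ∧ Above w d c) ∨ (d < c ∧ Above w c d)

lemma Inverted.symm {c d : Fin (n + 1)} (h : Inverted w c d) : Inverted w d c := Or.symm h

lemma exists_crossing_of_inverted {c d : Fin (n + 1)} (h : Inverted (pre Q J m) c d) :
    ∃ k, k < m ∧ k ∉ J ∧ IsPairAt Q J k c d := by
  rcases h with ⟨h, h'⟩ | ⟨h, h'⟩
  · obtain ⟨k, hk, hkJ, h1, h2⟩ := exists_crossing h h'
    exact ⟨k, hk, hkJ, Or.inl ⟨h1, h2⟩⟩
  · obtain ⟨k, hk, hkJ, h1, h2⟩ := exists_crossing h h'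
    exact ⟨k, hk, hkJ, Or.inr ⟨h1, h2⟩⟩

/-- The data of a flip of the facet `J`, exchanging `j ∈ J` with `k ∉ J`. -/
structure IsFlip (Q : ℕ → Fin n) (m : ℕ) (w : Equiv.Perm (Fin (n + 1))) (J : Finset ℕ) (j k : ℕ)
    (J' : Finset ℕ) (lo hi : ℕ) : Prop where
  lt : lo < hi
  hi_lt : hi < m
  k_lt : k < m
  k_notMem : k ∉ J
  pair : IsPairAt Q J k (upper Q J j) (lower Q J j)
  eq : J' = insert k (J.erase j)
  ends : (lo = j ∧ hi = k) ∨ (lo = k ∧ hi = j)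
  facet : FacetN Q m w J'
  pre_eq : ∀ l, pre Q J' l = if lo < l ∧ l ≤ hi then
    Equiv.swap (upper Q J j) (lower Q J j) * pre Q J l else pre Q J l
  above : ∀ l, lo < l → l ≤ hi → Above (pre Q J l) (upper Q J j) (lower Q J j)
  upper_hi : upper Q J hi = upper Q J j
  lower_hi : lower Q J hi = lower Q J j

/-- Since `w` inverts the two values at `j`, they cross at some used letter `k`. Exchanging `j` and
`k` reflects only the prefixes between them, so the product and the number of used letters are
unchanged. -/
lemma FacetN.exists_flip (hJ : FacetN Q m w J) {j : ℕ} (hj : j ∈ J)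
    (hinv : Inverted w (upper Q J j) (lower Q J j)) :
    ∃ k J' lo hi, IsFlip Q m w J j k J' lo hi := by
  have hjm : j < m := Finset.mem_range.1 (hJ.subset hj)
  obtain ⟨k, hkm, hkJ, hpair⟩ := exists_crossing_of_inverted (hJ.pre_eq.symm ▸ hinv)
  have hjk : j ≠ k := by rintro rfl; exact hkJ hj
  have hcard : (Finset.range m \ insert k (J.erase j)).card = (Finset.range m \ J).card := by
    have hs : insert k (J.erase j) ⊆ Finset.range m := by
      intro i hi
      rcases Finset.mem_insert.1 hi with rfl | hi
      · simpa using hkm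
      · exact hJ.subset (Finset.mem_of_mem_erase hi)
    rw [Finset.card_sdiff_of_subset hs, Finset.card_sdiff_of_subset hJ.subset,
      Finset.card_insert_of_notMem (by simp [hkJ]), Finset.card_erase_add_one hj]
  have hsub : insert k (J.erase j) ⊆ Finset.range m := by
    intro i hi
    rcases Finset.mem_insert.1 hi with rfl | hi
    · simpa using hkm
    · exact hJ.subset (Finset.mem_of_mem_erase hi)
  have hmemk : k ∈ insert k (J.erase j) ↔ k ∉ J := by simp [hkJ]
  have hmemj : j ∈ insert k (J.erase j) ↔ j ∉ J := by simp [hj, hjk]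
  rcases lt_or_gt_of_ne hjk with h | h
  · have hp := pre_toggle_toggle (Q := Q) (J := J) (J' := insert k (J.erase j)) h
      (fun i h1 h2 => by simp [h1, h2]) hmemj hmemk hpair
    -- Before their crossing the two values keep one order, so the roots at `j` and `k` coincide. In
    -- the case `k < j` below they are opposite.
    have hup : upper Q J k = upper Q J j ∧ lower Q J k = lower Q J j := by
      refine hpair.resolve_right fun h' => ?_
      have := hJ.above_of_le_crossing hkm hkJ h.le
      rw [h'.1, h'.2] at this
      exact this.asymm above_upper_lower
    refine ⟨k, _, j, k, h, hkm, hkm, hkJ, hpair, rfl, Or.inl ⟨rfl, rfl⟩, ⟨hsub, ?_, ?_⟩, hp, ?_,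
      hup.1, hup.2⟩
    · rw [hp, if_neg (by omega), hJ.pre_eq]
    · rw [hcard, hJ.card_eq]
    · intro l _ hl
      rw [← hup.1, ← hup.2]
      exact hJ.above_of_le_crossing hkm hkJ hl
  · have hdown : upper Q J k = lower Q J j ∧ lower Q J k = upper Q J j := by
      refine hpair.resolve_left fun h' => ?_
      have := hJ.above_of_crossing_lt hkm hkJ h hjm.le
      rw [h'.1, h'.2] at this
      exact this.asymm above_upper_lower
    have hp := pre_toggle_toggle (Q := Q) (J := J) (J' := insert k (J.erase j)) h
      (fun i h1 h2 => by simp [h1, h2]) hmemk hmemj (Or.inr ⟨hdown.2.symm, hdown.1.symm⟩)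
    rw [hdown.1, hdown.2, Equiv.swap_comm] at hp
    refine ⟨k, _, k, j, h, hjm, hkm, hkJ, hpair, rfl, Or.inr ⟨rfl, rfl⟩, ⟨hsub, ?_, ?_⟩, hp, ?_,
      rfl, rfl⟩
    · rw [hp, if_neg (by omega), hJ.pre_eq]
    · rw [hcard, hJ.card_eq]
    · intro l h1 h2
      rw [← hdown.1, ← hdown.2]
      exact hJ.above_of_crossing_lt hkm hkJ h1 (by omega)

end Prefixes

/-! ## Weights of prefixes -/

section Weights

variable {n : ℕ} {Γ : Type*} [AddCommGroup Γ]

/-- The value of the functional `e_i ↦ v i` at the image under `u` of the weight `∑_{q ≤ x} e_q`. -/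
def wsum (v : Fin (n + 1) → Γ) (u : Equiv.Perm (Fin (n + 1))) (x : Fin (n + 1)) : Γ :=
  ∑ q ∈ Finset.Iic x, v (u q)

-- Exchanging two values affects the sum over the positions up to `x` only if `x` separates them.
open scoped Classical in
lemma wsum_swap_mul (v : Fin (n + 1) → Γ) {u : Equiv.Perm (Fin (n + 1))} {c d : Fin (n + 1)}
    (h : Above u c d) (x : Fin (n + 1)) :
    wsum v (Equiv.swap c d * u) x =
      wsum v u x + if u⁻¹ c ≤ x ∧ x < u⁻¹ d then v d - v c else 0 := by
  have hterm : ∀ q, v ((Equiv.swap c d * u) q) = v (u q) +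
      ((if u⁻¹ c = q then v d - v c else 0) + if u⁻¹ d = q then v c - v d else 0) := by
    intro q
    simp only [Equiv.Perm.inv_eq_iff_eq, Equiv.Perm.mul_apply, Equiv.swap_apply_def]
    have := h.ne
    by_cases h1 : u q = c
    · simp [h1, this.symm]
    by_cases h2 : u q = d
    · simp [h2, this, this.symm]
    · simp [h1, h2, Ne.symm h1, Ne.symm h2]
  simp only [wsum, hterm, Finset.sum_add_distrib, Finset.sum_ite_eq, Finset.mem_Iic]
  congr 1
  have h' : u⁻¹ c < u⁻¹ d := h
  by_cases h1 : u⁻¹ d ≤ x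
  · rw [if_pos (h'.le.trans h1), if_pos h1, if_neg fun h2 => h2.2.not_ge h1]
    abel
  · rw [if_neg h1, add_zero]
    exact if_congr ⟨fun h2 => ⟨h2, not_le.1 h1⟩, fun h2 => h2.1⟩ rfl rfl

lemma comp_eq_of_wsum_eq {v : Fin (n + 1) → Γ} {u u' : Equiv.Perm (Fin (n + 1))}
    (h : ∀ x, wsum v u x = wsum v u' x) (x : Fin (n + 1)) : v (u x) = v (u' x) := by
  induction x using Fin.cases with
  | zero =>
    have h0 : Finset.Iic (0 : Fin (n + 1)) = {0} := by
      ext q; simp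
    simpa [wsum, h0] using h 0
  | succ p =>
    have hs : Finset.Iic p.succ = insert p.succ (Finset.Iic p.castSucc) := by
      ext q
      simp only [Finset.mem_Iic, Finset.mem_insert, Fin.le_def, Fin.ext_iff, Fin.val_succ,
        Fin.val_castSucc]
      omega
    have h1 := h p.succ
    have h2 := h p.castSucc
    have hn : p.succ ∉ Finset.Iic p.castSucc := by
      simp [Fin.le_def]
    simp only [wsum] at h1 h2
    rw [hs, Finset.sum_insert hn, Finset.sum_insert hn, h2] at h1
    exact add_right_cancel h1

lemma wsum_congr {v : Fin (n + 1) → Γ} {u u' : Equiv.Perm (Fin (n + 1))}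
    (h : ∀ x, v (u x) = v (u' x)) (x : Fin (n + 1)) : wsum v u x = wsum v u' x :=
  Finset.sum_congr rfl fun _ _ => h _

variable {Q : ℕ → Fin n} {J J' : Finset ℕ} {m j k lo hi : ℕ} {w : Equiv.Perm (Fin (n + 1))}

open scoped Classical in
lemma IsFlip.wsum_eq (h : IsFlip Q m w J j k J' lo hi) (v : Fin (n + 1) → Γ) (l : ℕ)
    (x : Fin (n + 1)) :
    wsum v (pre Q J' l) x = wsum v (pre Q J l) x +
      if (lo < l ∧ l ≤ hi) ∧ (pre Q J l)⁻¹ (upper Q J j) ≤ x ∧ x < (pre Q J l)⁻¹ (lower Q J j)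
        then v (lower Q J j) - v (upper Q J j) else 0 := by
  rw [h.pre_eq l]
  by_cases hl : lo < l ∧ l ≤ hi
  · rw [if_pos hl, wsum_swap_mul v (h.above l hl.1 hl.2)]
    simp only [hl, true_and]
  · simp [hl]

/-- At `hi` the two values occupy the adjacent positions separated by the letter, so the weight
there really changes. This is what makes improvements by flips strict. -/
lemma IsFlip.wsum_hi (h : IsFlip Q m w J j k J' lo hi) (v : Fin (n + 1) → Γ) :
    wsum v (pre Q J' hi) (Q hi).castSucc = wsum v (pre Q J hi) (Q hi).castSucc +
      (v (lower Q J j) - v (upper Q J j)) := by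
  classical
  rw [h.wsum_eq, if_pos]
  refine ⟨⟨h.lt, le_rfl⟩, ?_, ?_⟩
  · rw [← h.upper_hi, upper, Equiv.Perm.inv_def, Equiv.symm_apply_apply]
  · rw [← h.lower_hi, lower, Equiv.Perm.inv_def, Equiv.symm_apply_apply]
    exact Fin.castSucc_lt_succ

lemma IsFlip.wsum_eq_or (h : IsFlip Q m w J j k J' lo hi) (v : Fin (n + 1) → Γ) (l : ℕ)
    (x : Fin (n + 1)) :
    wsum v (pre Q J' l) x = wsum v (pre Q J l) x ∨ wsum v (pre Q J' l) x =
      wsum v (pre Q J l) x + (v (lower Q J j) - v (upper Q J j)) := by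
  classical
  rw [h.wsum_eq]
  split_ifs
  · exact Or.inr rfl
  · exact Or.inl (add_zero _)

/-- The sum of the weights at all positions; it is minus the functional on the brick vector. -/
def weightTotal (Q : ℕ → Fin n) (m : ℕ) (v : Fin (n + 1) → Γ) (J : Finset ℕ) : Γ :=
  ∑ l ∈ Finset.range m, wsum v (pre Q J l) (Q l).castSucc

/-- A flip moves the brick vector by a positive multiple of the root. -/
lemma IsFlip.weightTotal_eq (h : IsFlip Q m w J j k J' lo hi) :
    ∃ c : ℕ, 0 < c ∧ ∀ {Γ : Type} [AddCommGroup Γ] (v : Fin (n + 1) → Γ),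
      weightTotal Q m v J' = weightTotal Q m v J + c • (v (lower Q J j) - v (upper Q J j)) := by
  classical
  -- The multiple counts the positions whose weight changes. It does not depend on `v`, and `hi` is
  -- among these positions.
  refine ⟨((Finset.range m).filter fun l => (lo < l ∧ l ≤ hi) ∧
    (pre Q J l)⁻¹ (upper Q J j) ≤ (Q l).castSucc ∧
      (Q l).castSucc < (pre Q J l)⁻¹ (lower Q J j)).card, ?_, ?_⟩
  · refine Finset.card_pos.2 ⟨hi, ?_⟩
    rw [Finset.mem_filter, ← h.upper_hi, ← h.lower_hi, upper, lower, Equiv.Perm.inv_def,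
      Equiv.symm_apply_apply, Equiv.symm_apply_apply]
    exact ⟨Finset.mem_range.2 h.hi_lt, ⟨h.lt, le_rfl⟩, le_rfl, Fin.castSucc_lt_succ⟩
  · intro Γ _ v
    simp only [weightTotal, h.wsum_eq, Finset.sum_add_distrib, ← Finset.sum_filter,
      Finset.sum_const]

lemma IsFlip.subset (h : IsFlip Q m w J j k J' lo hi) {I : Finset ℕ} (hI : I ⊆ J) (hj : j ∉ I) :
    I ⊆ J' := by
  intro i hi
  rw [h.eq]
  refine Finset.mem_insert_of_mem (Finset.mem_erase.2 ⟨?_, hI hi⟩)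
  rintro rfl; exact hj hi

end Weights

/-! ## Locally optimal facets -/

section LocallyOptimal

variable {n : ℕ} {Q : ℕ → Fin n} {I J J' : Finset ℕ} {m j k lo hi : ℕ}
  {w : Equiv.Perm (Fin (n + 1))}

/-- The functional `e_i ↦ v i` is nonpositive on the roots at the positions in `J ∖ I`. -/
def LocOpt {Γ : Type*} [LE Γ] (Q : ℕ → Fin n) (I J : Finset ℕ) (v : Fin (n + 1) → Γ) : Prop :=
  ∀ j ∈ J, j ∉ I → v (upper Q J j) ≤ v (lower Q J j)

lemma LocOpt.notMem_of_strictAnti {Γ : Type*} [Preorder Γ] {v : Fin (n + 1) → Γ}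
    (hv : StrictAnti v) (h : LocOpt Q I J v) (hJ' : FacetN Q m w J') (hI' : I ⊆ J')
    (hk : k < m) (hpre : pre Q J k = pre Q J' k) (hkJ : k ∉ J') : k ∉ J := by
  intro hk'
  have h1 := h k hk' fun hkI => hkJ (hI' hkI)
  have h2 := hJ'.upper_lt_lower hk hkJ
  rw [upper, lower, hpre] at h1
  exact (hv h2).not_ge h1

/-- For decreasing `v` the roots at omitted positions outside `I` are negative, while used letters
have positive roots. Reading from left to right, the common prefix fixes the sign of the next root
and so decides whether its letter is used; positions in `I` are omitted by both facets. -/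
lemma eq_of_locOpt_of_strictAnti {Γ : Type*} [Preorder Γ] {v : Fin (n + 1) → Γ}
    (hv : StrictAnti v) (hJ : FacetN Q m w J) (hJ' : FacetN Q m w J') (hI : I ⊆ J) (hI' : I ⊆ J')
    (h : LocOpt Q I J v) (h' : LocOpt Q I J' v) : J = J' := by
  have key : ∀ k ≤ m, pre Q J k = pre Q J' k ∧ ∀ i < k, (i ∈ J ↔ i ∈ J') := by
    intro k
    induction k with
    | zero => simp
    | succ k ih =>
      intro hk
      obtain ⟨h1, h2⟩ := ih (by omega)
      have h3 : k ∈ J ↔ k ∈ J' := not_iff_not.1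
        ⟨h'.notMem_of_strictAnti hv hJ hI hk h1.symm, h.notMem_of_strictAnti hv hJ' hI' hk h1⟩
      refine ⟨by simp [pre, h1, h3], fun i hi => ?_⟩
      rcases Nat.lt_succ_iff_lt_or_eq.1 hi with h4 | rfl
      · exact h2 i h4
      · exact h3
  ext i
  by_cases hi : i < m
  · exact (key m le_rfl).2 i hi
  · exact ⟨fun h => absurd (Finset.mem_range.1 (hJ.subset h)) hi,
      fun h => absurd (Finset.mem_range.1 (hJ'.subset h)) hi⟩

/-- Exchanging two values that are adjacent in the order affects only the comparison between these
two. -/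
lemma le_swap_of_le {α Γ : Type*} [DecidableEq α] [LinearOrder Γ] {v : α → Γ}
    (hv : Function.Injective v) {a b : α} (hab : v a < v b)
    (hadj : ∀ c, ¬ (v a < v c ∧ v c < v b)) {c d : α} (h : v c ≤ v d)
    (hne : ¬ (c = a ∧ d = b)) :
    v (Equiv.swap a b c) ≤ v (Equiv.swap a b d) := by
  have hlow : ∀ d, v a ≤ v d → d ≠ a → v b ≤ v d := fun d h1 h2 =>
    not_lt.1 fun h3 => hadj d ⟨lt_of_le_of_ne h1 fun h4 => h2 (hv h4.symm), h3⟩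
  have hupp : ∀ c, v c ≤ v b → c ≠ b → v c ≤ v a := fun c h1 h2 =>
    not_lt.1 fun h3 => hadj c ⟨h3, lt_of_le_of_ne h1 fun h4 => h2 (hv h4)⟩
  have hne' : a ≠ b := by rintro rfl; exact lt_irrefl _ hab
  by_cases hca : c = a
  · subst hca
    have hdb : d ≠ b := fun h => hne ⟨rfl, h⟩
    by_cases hda : d = c
    · rw [hda]
    · rw [Equiv.swap_apply_left, Equiv.swap_apply_of_ne_of_ne hda hdb]
      exact hlow d h hda
  by_cases hcb : c = b
  · subst hcb
    rw [Equiv.swap_apply_right]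
    by_cases hda : d = a
    · subst hda; exact absurd h hab.not_ge
    by_cases hdb : d = c
    · rw [hdb, Equiv.swap_apply_right]
    · rw [Equiv.swap_apply_of_ne_of_ne hda hdb]
      exact hab.le.trans h
  rw [Equiv.swap_apply_of_ne_of_ne hca hcb]
  by_cases hda : d = a
  · subst hda
    rw [Equiv.swap_apply_left]
    exact h.trans hab.le
  by_cases hdb : d = b
  · subst hdb
    rw [Equiv.swap_apply_right]
    exact hupp c h hcb
  · rwa [Equiv.swap_apply_of_ne_of_ne hda hdb]

lemma FacetN.pair_crossing_lt (hJ : FacetN Q m w J) {a b : Fin (n + 1)} (hab : a < b)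
    (hk : k < m) (hkJ : k ∉ J) (h : IsPairAt Q J k a b) : upper Q J k = a ∧ lower Q J k = b := by
  refine h.resolve_right fun h' => ?_
  have := hJ.upper_lt_lower hk hkJ
  rw [h'.1, h'.2] at this
  exact this.asymm hab

/-- Swapping two adjacent values of `v` transforms locally optimal facets into locally optimal
facets, by at most one flip. -/
lemma LocOpt.step {Γ : Type*} [LinearOrder Γ] {v : Fin (n + 1) → Γ}
    (hv : Function.Injective v) {a b : Fin (n + 1)} (hab : a < b) (hvab : v a < v b)
    (hadj : ∀ c, ¬ (v a < v c ∧ v c < v b)) (hw : Inverted w a b)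
    (hJ : FacetN Q m w J) (hI : I ⊆ J) (h : LocOpt Q I J v) :
    (LocOpt Q I J (v ∘ Equiv.swap a b) ∧ ∀ l ∈ J, l ∉ I → ¬ IsPairAt Q J l a b) ∨
    ∃ j k J₁, j ∈ J ∧ k ∉ J ∧ J₁ = insert k (J.erase j) ∧ FacetN Q m w J₁ ∧ I ⊆ J₁ ∧ j < m ∧
      LocOpt Q I J₁ (v ∘ Equiv.swap a b) ∧ j ∉ J₁ ∧ IsPairAt Q J₁ j a b ∧
      k ∈ J₁ ∧ k ∉ I ∧ IsPairAt Q J₁ k a b ∧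
      ∀ l ∈ J₁, l ∉ I → IsPairAt Q J₁ l a b → l ≤ k := by
  classical
  have hdir : ∀ l ∈ J, l ∉ I → IsPairAt Q J l a b → upper Q J l = a ∧ lower Q J l = b := by
    intro l hl hlI hp
    refine hp.resolve_right fun h' => ?_
    have := h l hl hlI
    rw [h'.1, h'.2] at this
    exact this.not_gt hvab
  by_cases hS : (J.filter fun l => l ∉ I ∧ IsPairAt Q J l a b).Nonempty
  · right
    obtain ⟨j, hjS, hjmin⟩ := Finset.exists_min_image _ id hS
    obtain ⟨hj, hjI, hjp⟩ := Finset.mem_filter.1 hjS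
    have hmin : ∀ l ∈ J, l ∉ I → IsPairAt Q J l a b → j ≤ l := fun l h1 h2 h3 =>
      hjmin l (Finset.mem_filter.2 ⟨h1, h2, h3⟩)
    obtain ⟨hju, hjl⟩ := hdir j hj hjI hjp
    obtain ⟨k, J₁, lo, hi, hf⟩ := hJ.exists_flip hj (by rwa [hju, hjl])
    have hpk : IsPairAt Q J k a b := by simpa only [hju, hjl] using hf.pair
    have hjk : lo = j ∧ hi = k := by
      refine hf.ends.resolve_right fun h' => ?_
      have h1 := hf.above (k + 1) (by omega) (by have := hf.lt; omega)
      obtain ⟨h2, h3⟩ := hJ.pair_crossing_lt hab hf.k_lt hf.k_notMem hpk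
      have h4 := above_lower_upper_succ (Q := Q) hf.k_notMem
      rw [h2, h3] at h4
      rw [hju, hjl] at h1
      exact h1.asymm h4
    obtain ⟨rfl, rfl⟩ := hjk
    have hpre := hf.pre_eq
    rw [hju, hjl] at hpre
    have hup : ∀ l, upper Q J₁ l = if lo < l ∧ l ≤ hi then Equiv.swap a b (upper Q J l) else
        upper Q J l := fun l => by
      rw [upper, hpre]; split_ifs <;> rfl
    have hlow : ∀ l, lower Q J₁ l = if lo < l ∧ l ≤ hi then Equiv.swap a b (lower Q J l) else
        lower Q J l := fun l => by
      rw [lower, hpre]; split_ifs <;> rfl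
    have hpair : ∀ l, IsPairAt Q J₁ l a b ↔ IsPairAt Q J l a b := by
      intro l
      unfold IsPairAt
      rw [hup, hlow]
      split_ifs
      · simp only [Equiv.swap_apply_eq_iff, Equiv.swap_apply_left, Equiv.swap_apply_right]
        exact or_comm
      · rfl
    -- After the crossing `b` stands above `a`, so the root `e_a - e_b` cannot occur any more.
    have hafter : ∀ l ∈ J, l ∉ I → IsPairAt Q J l a b → l ≤ hi := by
      intro l hl hlI hlp
      by_contra hcon
      obtain ⟨h1, h2⟩ := hdir l hl hlI hlp
      have h3 := hJ.above_of_crossing_lt (l := l) hf.k_lt hf.k_notMem (by omega)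
        (Finset.mem_range.1 (hJ.subset hl)).le
      rw [hf.upper_hi, hf.lower_hi, hju, hjl] at h3
      have h4 := above_upper_lower (Q := Q) (J := J) (k := l)
      rw [h1, h2] at h4
      exact h4.asymm h3
    have hmem : ∀ l, l ∈ J₁ ↔ l = hi ∨ (l ≠ lo ∧ l ∈ J) := by
      intro l; rw [hf.eq]; simp
    refine ⟨lo, hi, J₁, hj, hf.k_notMem, hf.eq, hf.facet, hf.subset hI hjI,
      Finset.mem_range.1 (hJ.subset hj), ?_, ?_, (hpair _).2 hjp, (hmem _).2 (Or.inl rfl),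
      fun h' => hf.k_notMem (hI h'), (hpair _).2 hpk, ?_⟩
    · intro l hl hlI
      rw [hup, hlow]
      simp only [Function.comp_apply]
      by_cases hin : lo < l ∧ l ≤ hi
      · simp only [if_pos hin, Equiv.swap_apply_self]
        rcases (hmem l).1 hl with rfl | ⟨-, hlJ⟩
        · rw [hf.upper_hi, hf.lower_hi, hju, hjl]; exact hvab.le
        · exact h l hlJ hlI
      · simp only [if_neg hin]
        rcases (hmem l).1 hl with rfl | ⟨hne, hlJ⟩
        · exact absurd ⟨hf.lt, le_rfl⟩ hin
        · refine le_swap_of_le hv hvab hadj (h l hlJ hlI) fun h' => hin ?_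
          have := hmin l hlJ hlI (Or.inl h')
          exact ⟨by omega, hafter l hlJ hlI (Or.inl h')⟩
    · rw [hmem]
      have := hf.lt
      omega
    · intro l hl hlI hlp
      rcases (hmem l).1 hl with rfl | ⟨-, hlJ⟩
      · exact le_rfl
      · exact hafter l hlJ hlI ((hpair l).1 hlp)
  · left
    have hS' : ∀ l ∈ J, l ∉ I → ¬ IsPairAt Q J l a b := fun l h1 h2 h3 =>
      hS ⟨l, Finset.mem_filter.2 ⟨h1, h2, h3⟩⟩
    exact ⟨fun l hl hlI => le_swap_of_le hv hvab hadj (h l hl hlI)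
      fun h' => hS' l hl hlI (Or.inl h'), hS'⟩

lemma FacetN.crossing_unique (hJ : FacetN Q m w J) {a b : Fin (n + 1)} (hab : a < b)
    (hj : j < m) (hk : k < m) (hjJ : j ∉ J) (hkJ : k ∉ J) (h : IsPairAt Q J j a b)
    (h' : IsPairAt Q J k a b) : j = k := by
  have key : ∀ {j k : ℕ}, j < k → j < m → k < m → j ∉ J → k ∉ J → IsPairAt Q J j a b →
      IsPairAt Q J k a b → False := by
    intro j k hjk hj hk hjJ hkJ h h'
    obtain ⟨h1, h2⟩ := hJ.pair_crossing_lt hab hj hjJ h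
    obtain ⟨h3, h4⟩ := hJ.pair_crossing_lt hab hk hkJ h'
    have h5 := hJ.above_of_crossing_lt hj hjJ hjk hk.le
    have h6 := above_upper_lower (Q := Q) (J := J) (k := k)
    rw [h1, h2] at h5
    rw [h3, h4] at h6
    exact h6.asymm h5
  rcases lt_trichotomy j k with h1 | h1 | h1
  · exact (key h1 hj hk hjJ hkJ h h').elim
  · exact h1
  · exact (key h1 hk hj hkJ hjJ h' h).elim

/-- Take an increasing pair with the smallest difference of values: a value strictly between would
form a closer increasing pair with one of its ends. -/
lemma exists_adjacent_values {α Γ : Type*} [Fintype α] [LinearOrder α] [AddCommGroup Γ]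
    [LinearOrder Γ] [IsOrderedAddMonoid Γ] {v : α → Γ} (hv : Function.Injective v)
    (h : ¬ StrictAnti v) :
    ∃ a b, a < b ∧ v a < v b ∧ ∀ c, ¬ (v a < v c ∧ v c < v b) := by
  classical
  have hne : (Finset.univ.filter fun x : α × α => x.1 < x.2 ∧ v x.1 < v x.2).Nonempty := by
    unfold StrictAnti at h
    push Not at h
    obtain ⟨a, b, hab, hle⟩ := h
    exact ⟨(a, b), by simpa [hab] using lt_of_le_of_ne hle fun h' => hab.ne (hv h')⟩
  obtain ⟨⟨a, b⟩, hmem, hmin⟩ := Finset.exists_min_image _ (fun x => v x.2 - v x.1) hne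
  simp only [Finset.mem_filter, Finset.mem_univ, true_and, Prod.forall] at hmem hmin
  refine ⟨a, b, hmem.1, hmem.2, fun c hc => ?_⟩
  have hcb : c ≠ b := by rintro rfl; exact lt_irrefl _ hc.2
  rcases lt_or_gt_of_ne hcb with h1 | h1
  · have := hmin c b ⟨h1, hc.2⟩
    exact absurd hc.1 ((sub_le_sub_iff_left (v b)).1 this).not_gt
  · have := hmin a c ⟨hmem.1.trans h1, hc.1⟩
    exact absurd hc.2 ((sub_le_sub_iff_right (v a)).1 this).not_gt

/-- For an injective `v` there is at most one locally optimal facet. -/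
lemma eq_of_locOpt {Γ : Type*} [AddCommGroup Γ] [LinearOrder Γ] [IsOrderedAddMonoid Γ]
    {v : Fin (n + 1) → Γ} (hv : Function.Injective v) (hw : ∀ a b, a < b → Inverted w a b)
    (hJ : FacetN Q m w J) (hJ' : FacetN Q m w J') (hI : I ⊆ J) (hI' : I ⊆ J')
    (h : LocOpt Q I J v) (h' : LocOpt Q I J' v) : J = J' := by
  classical
  -- The induction is on the number of pairs on which `v` increases: exchanging two adjacent values
  -- removes such a pair and creates none, ending at a decreasing `v`.
  induction hN : (Finset.univ.filter fun x : Fin (n + 1) × Fin (n + 1) =>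
    x.1 < x.2 ∧ v x.1 < v x.2).card using Nat.strong_induction_on generalizing v J J' with
  | _ N ih =>
    by_cases hanti : StrictAnti v
    · exact eq_of_locOpt_of_strictAnti hanti hJ hJ' hI hI' h h'
    obtain ⟨a, b, hab, hvab, hadj⟩ := exists_adjacent_values hv hanti
    have hlt : (Finset.univ.filter fun x : Fin (n + 1) × Fin (n + 1) =>
        x.1 < x.2 ∧ (v ∘ Equiv.swap a b) x.1 < (v ∘ Equiv.swap a b) x.2).card < N := by
      rw [← hN]
      apply Finset.card_lt_card
      rw [Finset.ssubset_iff_of_subset]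
      · exact ⟨(a, b), by simp [hab, hvab], by simp [hvab.le]⟩
      · rintro ⟨c, d⟩
        simp only [Finset.mem_filter, Finset.mem_univ, true_and, Function.comp_apply]
        rintro ⟨hcd, h1⟩
        refine ⟨hcd, not_le.1 fun h2 => h1.not_ge (le_swap_of_le hv hvab hadj h2 ?_)⟩
        rintro ⟨rfl, rfl⟩
        exact hcd.asymm hab
    have ih' := fun {J J' : Finset ℕ} => ih _ hlt (v := v ∘ Equiv.swap a b) (J := J) (J' := J')
      (hv.comp (Equiv.injective _))
    rcases h.step hv hab hvab hadj (hw a b hab) hJ hI with ⟨h1, h2⟩ |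
      ⟨j, k, J₁, hj, hk, hJ₁, hF, hIJ, hjm, h1, hjJ, hjp, hkJ, hkI, hkp, hmax⟩ <;>
    rcases h'.step hv hab hvab hadj (hw a b hab) hJ' hI' with ⟨h1', h2'⟩ |
      ⟨j', k', J₁', hj', hk', hJ₁', hF', hIJ', hjm', h1', hjJ', hjp', hkJ', hkI', hkp', hmax'⟩
    · exact ih' hJ hJ' hI hI' h1 h1' rfl
    -- A flipped facet still omits a position with the pair `a, b` outside `I`, an unflipped one
    -- does not, so the mixed cases cannot occur.
    · have := ih' hJ hF' hI hIJ' h1 h1' rfl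
      subst this
      exact absurd hkp' (h2 k' hkJ' hkI')
    · have := ih' hF hJ' hIJ hI' h1 h1' rfl
      subst this
      exact absurd hkp (h2' k hkJ hkI)
    -- The flip can be undone from its result: `k` is the last omitted position outside `I` with the
    -- pair `a, b`, and `j` is the only crossing of this pair.
    · have := ih' hF hF' hIJ hIJ' h1 h1' rfl
      subst this
      obtain rfl : k = k' := le_antisymm (hmax' k hkJ hkI hkp) (hmax k' hkJ' hkI' hkp')
      obtain rfl : j = j' := hF.crossing_unique hab hjm hjm' hjJ hjJ' hjp hjp'
      rw [hJ₁] at hJ₁'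
      have h3 := congrArg (fun s => insert j (Finset.erase s k)) hJ₁'
      simpa [Finset.erase_insert, hk, hk', Finset.insert_erase, hj, hj'] using h3

end LocallyOptimal

/-! ## Locally optimal facets minimize all weights -/

section Optimality

variable {n : ℕ} {Q : ℕ → Fin n} {I J J' : Finset ℕ} {m j k lo hi : ℕ}
  {w : Equiv.Perm (Fin (n + 1))}

lemma exists_facet_min {Λ : Type*} [LinearOrder Λ] (P : Finset ℕ → Prop)
    (hP : ∀ J, P J → FacetN Q m w J) (hne : ∃ J, P J) (f : Finset ℕ → Λ) :
    ∃ J, P J ∧ ∀ J', P J' → f J ≤ f J' := by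
  classical
  obtain ⟨J₀, hJ₀⟩ := hne
  have hmem : ∀ J, P J → J ∈ (Finset.range m).powerset.filter P := fun J hJ =>
    Finset.mem_filter.2 ⟨Finset.mem_powerset.2 (hP J hJ).subset, hJ⟩
  obtain ⟨J, hJ, hmin⟩ := Finset.exists_min_image _ f ⟨J₀, hmem J₀ hJ₀⟩
  exact ⟨J, (Finset.mem_filter.1 hJ).2, fun J' hJ' => hmin J' (hmem J' hJ')⟩

lemma IsFlip.wsum_le {Γ : Type*} [AddCommGroup Γ] [LinearOrder Γ] [IsOrderedAddMonoid Γ]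
    (h : IsFlip Q m w J j k J' lo hi) {v : Fin (n + 1) → Γ}
    (hv : v (lower Q J j) ≤ v (upper Q J j)) (l : ℕ) (x : Fin (n + 1)) :
    wsum v (pre Q J' l) x ≤ wsum v (pre Q J l) x := by
  rcases h.wsum_eq_or v l x with h1 | h1
  · exact h1.le
  · rw [h1]
    exact add_le_of_nonpos_right (sub_nonpos.2 hv)

lemma IsFlip.weightTotal_lt {Γ : Type*} [AddCommGroup Γ] [LinearOrder Γ] [IsOrderedAddMonoid Γ]
    (h : IsFlip Q m w J j k J' lo hi) {v : Fin (n + 1) → Γ}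
    (hv : v (lower Q J j) < v (upper Q J j)) : weightTotal Q m v J' < weightTotal Q m v J := by
  refine Finset.sum_lt_sum (fun l _ => h.wsum_le hv.le l _) ⟨hi, Finset.mem_range.2 h.hi_lt, ?_⟩
  rw [h.wsum_hi]
  exact add_lt_of_neg_right _ (sub_neg.2 hv)

/-- Minimize the chosen weight first and the total second. A flip at a violating root never raises
the chosen weight and strictly lowers the total, so the minimizer is locally optimal, and uniqueness
identifies it with `J` whatever `l` and `x` are. -/
lemma wsum_le_of_locOpt_of_injective {Γ : Type*} [AddCommGroup Γ] [LinearOrder Γ]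
    [IsOrderedAddMonoid Γ] {v : Fin (n + 1) → Γ} (hv : Function.Injective v)
    (hw : ∀ a b, a < b → Inverted w a b) (hJ : FacetN Q m w J) (hJ' : FacetN Q m w J')
    (hI : I ⊆ J) (hI' : I ⊆ J') (h : LocOpt Q I J v) (l : ℕ) (x : Fin (n + 1)) :
    wsum v (pre Q J l) x ≤ wsum v (pre Q J' l) x := by
  obtain ⟨K, ⟨hK, hIK⟩, hmin⟩ := exists_facet_min (fun J => FacetN Q m w J ∧ I ⊆ J)
    (fun J h => h.1) ⟨J, hJ, hI⟩
    (fun J => toLex (wsum v (pre Q J l) x, weightTotal Q m v J))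
  have hKopt : LocOpt Q I K v := by
    intro j hj hjI
    by_contra hcon
    rw [not_le] at hcon
    have hinv : Inverted w (upper Q K j) (lower Q K j) := by
      rcases lt_or_gt_of_ne (upper_ne_lower (Q := Q) (J := K) (k := j)) with h1 | h1
      · exact hw _ _ h1
      · exact (hw _ _ h1).symm
    obtain ⟨k, K', lo, hi, hf⟩ := hK.exists_flip hj hinv
    have h1 := hmin K' ⟨hf.facet, hf.subset hIK hjI⟩
    refine h1.not_gt (Prod.Lex.toLex_lt_toLex.2 ?_)
    rcases (hf.wsum_le hcon.le l x).lt_or_eq with h2 | h2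
    · exact Or.inl h2
    · exact Or.inr ⟨h2, hf.weightTotal_lt hcon⟩
  obtain rfl := eq_of_locOpt hv hw hJ hK hI hIK h hKopt
  exact Prod.Lex.monotone_fst_ofLex (hmin J' ⟨hJ', hI'⟩)

lemma wsum_toLex (v : Fin (n + 1) → ℝ) (g : Fin (n + 1) → ℤ) (u : Equiv.Perm (Fin (n + 1)))
    (x : Fin (n + 1)) :
    wsum (fun i => toLex (v i, g i)) u x = toLex (wsum v u x, wsum g u x) := by
  simp only [wsum]
  induction Finset.Iic x using Finset.induction_on with
  | empty => rfl
  | insert a s ha ih => rw [Finset.sum_insert ha, Finset.sum_insert ha, Finset.sum_insert ha, ih]; rfl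

/-- The perturbation `i ↦ (v i, i)`, ordered lexicographically, is injective. As `J` need not be
locally optimal for it, `J` is replaced by a facet with the same `v`-weights that minimizes the
total of the second coordinate. -/
lemma wsum_le_of_locOpt_of_longest {v : Fin (n + 1) → ℝ}
    (hw : ∀ a b, a < b → Inverted w a b) (hJ : FacetN Q m w J) (hJ' : FacetN Q m w J')
    (hI : I ⊆ J) (hI' : I ⊆ J') (h : LocOpt Q I J v) (l : ℕ) (x : Fin (n + 1)) :
    wsum v (pre Q J l) x ≤ wsum v (pre Q J' l) x := by
  set g : Fin (n + 1) → ℤ := fun i => i.val with hg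
  obtain ⟨K, ⟨hK, hIK, hKopt, hKeq⟩, hmin⟩ := exists_facet_min
    (fun K => FacetN Q m w K ∧ I ⊆ K ∧ LocOpt Q I K v ∧
      ∀ l x, wsum v (pre Q K l) x = wsum v (pre Q J l) x)
    (fun K h => h.1) ⟨J, hJ, hI, h, fun _ _ => rfl⟩ (fun K => weightTotal Q m g K)
  have hKlex : LocOpt Q I K (fun i => toLex (v i, g i)) := by
    intro j hj hjI
    rw [Prod.Lex.toLex_le_toLex]
    rcases (hKopt j hj hjI).lt_or_eq with h1 | h1
    · exact Or.inl h1
    refine Or.inr ⟨h1, ?_⟩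
    by_contra hcon
    rw [not_le] at hcon
    have hinv : Inverted w (upper Q K j) (lower Q K j) := by
      rcases lt_or_gt_of_ne (upper_ne_lower (Q := Q) (J := K) (k := j)) with h1 | h1
      · exact hw _ _ h1
      · exact (hw _ _ h1).symm
    obtain ⟨k, K', lo, hi, hf⟩ := hK.exists_flip hj hinv
    -- On a tie the flip reflects in a root on which `v` vanishes, so no `v`-value changes and the
    -- flipped facet still competes in the minimization.
    have hsw : ∀ i, v (Equiv.swap (upper Q K j) (lower Q K j) i) = v i := by
      intro i
      rw [Equiv.swap_apply_def]
      split_ifs with h2 h3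
      · rw [h2, h1]
      · rw [h3, h1]
      · rfl
    have hpre : ∀ l i, v (pre Q K' l i) = v (pre Q K l i) := by
      intro l i
      rw [hf.pre_eq]
      split_ifs
      · exact hsw _
      · rfl
    refine (hmin K' ⟨hf.facet, hf.subset hIK hjI, ?_, fun l x => ?_⟩).not_gt
      (hf.weightTotal_lt hcon)
    · intro i hi hiI
      rw [upper, lower, hpre, hpre]
      rw [hf.eq, Finset.mem_insert, Finset.mem_erase] at hi
      rcases hi with rfl | hi
      · change v (upper Q K i) ≤ v (lower Q K i)
        rcases hf.pair with ⟨h2, h3⟩ | ⟨h2, h3⟩ <;> rw [h2, h3, h1]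
      · exact hKopt i hi.2 hiI
    · rw [← hKeq]
      exact wsum_congr (hpre l) x
  have hinj : Function.Injective (fun i => toLex (v i, g i)) := by
    intro a b hab
    have := congrArg (fun z => (ofLex z).2) hab
    exact Fin.ext (by simpa [hg] using this)
  have := wsum_le_of_locOpt_of_injective hinj hw hK hJ' hIK hI' hKlex l x
  rw [wsum_toLex, wsum_toLex] at this
  have h3 := Prod.Lex.monotone_fst_ofLex this
  rw [← hKeq]
  exact h3

/-! ### Reduction to the longest element, and the case of equality. -/

lemma pre_congr {Q' : ℕ → Fin n} {l : ℕ} (h : ∀ i < l, Q' i = Q i) : pre Q' J l = pre Q J l := by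
  induction l with
  | zero => rfl
  | succ l ih =>
    rw [pre, pre, ih fun i hi => h i (by omega), h l (by omega)]

lemma FacetN.congr {Q' : ℕ → Fin n} (hJ : FacetN Q m w J) (h : ∀ i < m, Q' i = Q i) :
    FacetN Q' m w J :=
  ⟨hJ.subset, by rw [pre_congr h, hJ.pre_eq], hJ.card_eq⟩

/-- Letters can be appended to a word until `w` becomes the longest element. -/
lemma exists_extension (Q : ℕ → Fin n) (m : ℕ) (w : Equiv.Perm (Fin (n + 1))) :
    ∃ (Q' : ℕ → Fin n) (m' : ℕ) (w' : Equiv.Perm (Fin (n + 1))), m ≤ m' ∧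
      (∀ i < m, Q' i = Q i) ∧ (∀ a b, a < b → Inverted w' a b) ∧
      ∀ J, FacetN Q m w J → FacetN Q' m' w' J := by
  classical
  induction hN : (inversions w)ᶜ.card using Nat.strong_induction_on generalizing Q m w with
  | _ N ih =>
    by_cases hall : ∀ p : Fin n, w p.succ < w p.castSucc
    · refine ⟨Q, m, w, le_rfl, fun _ _ => rfl, fun a b hab => Or.inl ⟨hab, ?_⟩, fun _ h => h⟩
      have hanti : StrictAnti w := Fin.strictAnti_iff_succ_lt.2 hall
      refine (above_or_above w hab.ne').resolve_right fun h => ?_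
      have := hanti h
      simp only [Equiv.Perm.inv_def, Equiv.apply_symm_apply] at this
      exact this.asymm hab
    · push Not at hall
      obtain ⟨p, hp⟩ := hall
      have hp' : w p.castSucc < w p.succ :=
        (apply_castSucc_lt_or_gt w p).resolve_right hp.not_gt
      have hcard := card_inversions_mul_of_lt hp'
      have h1 := Finset.card_compl_add_card (inversions w)
      have h2 := Finset.card_compl_add_card (inversions (w * simpleTransposition p))
      -- Append the letter of an ascent of `w`. Every old facet uses the new letter, so it stays a
      -- facet as the same set of omitted positions.
      obtain ⟨Q', m', w', hm, hQ, hw, hJ⟩ :=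
        ih _ (by omega) (Function.update Q m p) (m + 1) (w * simpleTransposition p) rfl
      have hup : ∀ i < m, Function.update Q m p i = Q i := fun i hi =>
        Function.update_of_ne hi.ne _ _
      refine ⟨Q', m', w', by omega, fun i hi => ?_, hw, fun J hJF => hJ J ?_⟩
      · rw [hQ i (by omega), hup i hi]
      · have hmJ : m ∉ J := fun h => by simpa using hJF.subset h
        refine ⟨hJF.subset.trans (Finset.range_mono (Nat.le_succ m)), ?_, ?_⟩
        · rw [pre_succ_of_notMem hmJ, pre_congr hup, hJF.pre_eq, Function.update_self]
        · rw [card_range_succ_sdiff_of_notMem hmJ, hJF.card_eq, hcard]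

lemma LocOpt.congr {Γ : Type*} [LE Γ] {Q' : ℕ → Fin n} {v : Fin (n + 1) → Γ}
    (h : LocOpt Q I J v) (hJ : J ⊆ Finset.range m) (hQ : ∀ i < m, Q' i = Q i) :
    LocOpt Q' I J v := by
  intro j hj hjI
  have hjm := Finset.mem_range.1 (hJ hj)
  have := h j hj hjI
  rwa [upper, lower, ← pre_congr (Q' := Q') (fun i hi => hQ i (by omega)), ← hQ j hjm] at this

lemma wsum_le_of_locOpt {v : Fin (n + 1) → ℝ} (hJ : FacetN Q m w J) (hJ' : FacetN Q m w J')
    (hI : I ⊆ J) (hI' : I ⊆ J') (h : LocOpt Q I J v) {l : ℕ} (hl : l ≤ m) (x : Fin (n + 1)) :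
    wsum v (pre Q J l) x ≤ wsum v (pre Q J' l) x := by
  obtain ⟨Q', m', w', hm, hQ, hw, hF⟩ := exists_extension Q m w
  have := wsum_le_of_locOpt_of_longest hw (hF J hJ) (hF J' hJ') hI hI' (h.congr hJ.subset hQ) l x
  rwa [pre_congr fun i hi => hQ i (by omega), pre_congr fun i hi => hQ i (by omega)] at this

/-- If all weights of two facets agree under `v`, then `v` agrees on their prefixes. -/
lemma comp_pre_eq {Γ : Type*} [AddCommGroup Γ] {v : Fin (n + 1) → Γ} (hJ : FacetN Q m w J)
    (hJ' : FacetN Q m w J')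
    (h : ∀ l < m, wsum v (pre Q J l) (Q l).castSucc = wsum v (pre Q J' l) (Q l).castSucc)
    {l : ℕ} (hl : l ≤ m) (x : Fin (n + 1)) : v (pre Q J l x) = v (pre Q J' l x) := by
  -- Unless `x` separates the two positions exchanged by the letter, that letter permutes the
  -- positions up to `x`. Equality of weights therefore propagates backwards from the common product
  -- `w`; the remaining `x` is the hypothesis.
  have hstep : ∀ (J : Finset ℕ) (l : ℕ) (x : Fin (n + 1)), x ≠ (Q l).castSucc →
      wsum v (pre Q J (l + 1)) x = wsum v (pre Q J l) x := by
    intro J l x hx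
    by_cases hlJ : l ∈ J
    · rw [pre_succ_of_mem hlJ]
    rw [pre_succ_of_notMem hlJ]
    refine Finset.sum_equiv (simpleTransposition (Q l)) (fun i => ?_) (fun i _ => rfl)
    have hx' : x.val ≠ (Q l).val := fun h => hx (Fin.ext h)
    simp only [Finset.mem_Iic, simpleTransposition, Equiv.swap_apply_def, Fin.le_def,
      Fin.ext_iff, Fin.val_castSucc, Fin.val_succ]
    split_ifs <;> simp only [Fin.val_castSucc, Fin.val_succ] <;> omega
  have key : ∀ x, wsum v (pre Q J l) x = wsum v (pre Q J' l) x := by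
    induction hl using Nat.decreasingInduction with
    | self => intro x; rw [hJ.pre_eq, hJ'.pre_eq]
    | of_succ l hl ih =>
      intro x
      by_cases hx : x = (Q l).castSucc
      · rw [hx]; exact h l hl
      · rw [← hstep J l x hx, ← hstep J' l x hx]; exact ih x
  exact comp_eq_of_wsum_eq key x

/-- If the weight totals agree, then `v` agrees on the prefixes. -/
lemma LocOpt.comp_pre_eq {v : Fin (n + 1) → ℝ} (h : LocOpt Q I J v) (hJ : FacetN Q m w J)
    (hJ' : FacetN Q m w J') (hI : I ⊆ J) (hI' : I ⊆ J')
    (heq : weightTotal Q m v J' ≤ weightTotal Q m v J) {l : ℕ} (hl : l ≤ m) (x : Fin (n + 1)) :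
    v (pre Q J l x) = v (pre Q J' l x) := by
  have hle : ∀ l ∈ Finset.range m, wsum v (pre Q J l) (Q l).castSucc ≤
      wsum v (pre Q J' l) (Q l).castSucc := fun l hl =>
    wsum_le_of_locOpt hJ hJ' hI hI' h (Finset.mem_range.1 hl).le _
  have := (Finset.sum_eq_sum_iff_of_le hle).1 (le_antisymm (Finset.sum_le_sum hle) heq)
  exact BrickPolyhedra.comp_pre_eq hJ hJ' (fun l hl => this l (Finset.mem_range.2 hl)) hl x

/-- If the letter at `j` is omitted by one facet and used by the other, the next prefixes can agree
after `v` only if `v` takes equal values at the two ends of the root. -/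
lemma mem_of_comp_pre_eq {v : Fin (n + 1) → ℝ}
    (h : ∀ l ≤ m, ∀ x, v (pre Q J l x) = v (pre Q J' l x)) (hjm : j < m) (hj : j ∈ J)
    (hne : v (upper Q J j) ≠ v (lower Q J j)) : j ∈ J' := by
  by_contra hj'
  apply hne
  have h1 := h (j + 1) hjm (Q j).castSucc
  rw [pre_succ_of_mem hj, pre_succ_of_notMem hj', Equiv.Perm.mul_apply,
    simpleTransposition_castSucc, ← h j hjm.le] at h1
  exact h1

end Optimality

/-! ## The Bruhat order and subwords -/

section Bruhat

variable {n : ℕ} {Q : ℕ → Fin n} {I J J' : Finset ℕ} {m k l : ℕ}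
  {u w : Equiv.Perm (Fin (n + 1))} {a b : Fin (n + 1)}

lemma above_swap_mul {c d : Fin (n + 1)} : Above (Equiv.swap a b * u) c d ↔
    Above u (Equiv.swap a b c) (Equiv.swap a b d) := by
  rw [Above, mul_inv_rev, Equiv.swap_inv]; rfl

lemma pre_congr_right (h : ∀ i < l, (i ∈ J' ↔ i ∈ J)) : pre Q J' l = pre Q J l := by
  induction l with
  | zero => rfl
  | succ l ih =>
    rw [pre, pre, ih fun i hi => h i (by omega)]
    simp only [h l (by omega)]

lemma pre_eq_of_eq_of_le (hJ : J ⊆ Finset.range m) (hJ' : J' ⊆ Finset.range m)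
    (h : pre Q J m = pre Q J' m) (hl : m ≤ l) : pre Q J l = pre Q J' l := by
  induction l, hl using Nat.le_induction with
  | base => exact h
  | succ l hl ih =>
    rw [pre_succ_of_notMem fun h => (Finset.mem_range.1 (hJ h)).not_ge hl,
      pre_succ_of_notMem fun h => (Finset.mem_range.1 (hJ' h)).not_ge hl, ih]

/-- The strong exchange property. -/
lemma exists_pre_eq_swap_mul (hab : a < b) (h : Above (pre Q J m) b a) :
    ∃ k < m, k ∉ J ∧ upper Q J k = a ∧ lower Q J k = b ∧
      (∀ l, pre Q (insert k J) l = if l ≤ k then pre Q J l else Equiv.swap a b * pre Q J l) ∧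
      (Finset.range m \ insert k J).card + 1 = (Finset.range m \ J).card := by
  obtain ⟨k, hkm, hkJ, rfl, rfl⟩ := exists_crossing hab h
  refine ⟨k, hkm, hkJ, rfl, rfl, pre_toggle (fun i hi => by simp [hi]) (by simp [hkJ]), ?_⟩
  rw [Finset.sdiff_insert, Finset.card_erase_add_one]
  simp [hkm, hkJ]

lemma exists_pre_empty_eq [Nonempty (Fin n)] (u : Equiv.Perm (Fin (n + 1))) :
    ∃ Q : ℕ → Fin n, pre Q ∅ (inversions u).card = u := by
  obtain ⟨l, hl, hlk⟩ := exists_wordProd_eq u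
  obtain ⟨d⟩ := ‹Nonempty (Fin n)›
  refine ⟨fun i => l.getD i d, ?_⟩
  rw [← hlk, ← hl]
  clear hl hlk
  induction l using List.reverseRecOn with
  | nil => rfl
  | append_singleton l p ih =>
    rw [wordProd_append_singleton, List.length_append, List.length_singleton,
      pre_succ_of_notMem (by simp)]
    congr 1
    · rw [← ih]
      apply pre_congr
      intro i hi
      simp [List.getD, hi, List.getElem?_append_left]
    · simp [List.getD]

/-- Strong exchange in a shortest word for the larger permutation: deleting one letter yields a word
for `u`. -/
lemma card_inversions_lt_swap_mul (hab : a < b) (h : Above u a b) :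
    (inversions u).card < (inversions (Equiv.swap a b * u)).card := by
  have : Nonempty (Fin n) := by
    rcases n with _ | n
    · have := b.isLt
      exact absurd hab (by rw [Fin.lt_def]; omega)
    · exact ⟨0⟩
  obtain ⟨Q, hQ⟩ := exists_pre_empty_eq (Equiv.swap a b * u)
  obtain ⟨k, hk, -, -, -, hpre, hcard⟩ := exists_pre_eq_swap_mul (Q := Q) (J := ∅)
    (m := (inversions (Equiv.swap a b * u)).card) hab (by
      rw [hQ, above_swap_mul, Equiv.swap_apply_left, Equiv.swap_apply_right]; exact h)
  have h1 := hpre (inversions (Equiv.swap a b * u)).card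
  rw [if_neg (by omega), hQ, ← mul_assoc, Equiv.swap_mul_self, one_mul] at h1
  have h2 := (card_inversions_pre Q (insert k ∅) (inversions (Equiv.swap a b * u)).card).1
  rw [h1] at h2
  rw [Finset.sdiff_empty, Finset.card_range] at hcard
  omega

lemma bruhatStep_iff {v : Equiv.Perm (Fin (n + 1))} :
    BruhatStep u v ↔ ∃ a b, a < b ∧ Above u a b ∧ v = Equiv.swap a b * u := by
  simp only [BruhatStep, coxeterLength_eq]
  constructor
  · rintro ⟨t, ⟨a, b, hab, rfl⟩, rfl, hlt⟩
    wlog h : a < b generalizing a b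
    · rw [Equiv.swap_comm] at hlt ⊢
      exact this b a hab.symm hlt (lt_of_le_of_ne (not_lt.1 h) hab.symm)
    refine ⟨a, b, h, (above_or_above u hab).resolve_right fun h' => ?_, rfl⟩
    have := card_inversions_lt_swap_mul (u := Equiv.swap a b * u) h (by
      rw [above_swap_mul, Equiv.swap_apply_left, Equiv.swap_apply_right]; exact h')
    rw [← mul_assoc, Equiv.swap_mul_self, one_mul] at this
    exact this.asymm hlt
  · rintro ⟨a, b, hab, h, rfl⟩
    exact ⟨_, ⟨a, b, hab.ne, rfl⟩, rfl, card_inversions_lt_swap_mul hab h⟩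

lemma BruhatStep.card_lt {v : Equiv.Perm (Fin (n + 1))} (h : BruhatStep u v) :
    (inversions u).card < (inversions v).card := by
  obtain ⟨t, -, -, h⟩ := h
  rwa [coxeterLength_eq, coxeterLength_eq] at h

lemma BruhatLE.card_le {v : Equiv.Perm (Fin (n + 1))} (h : BruhatLE u v) :
    (inversions u).card ≤ (inversions v).card := by
  induction h with
  | refl => exact le_rfl
  | tail _ h ih => exact ih.trans h.card_lt.le

/-- The generator reverses the two values of the step only if these stand at its two positions, and
then the step is multiplication by the generator itself. -/
lemma bruhatStep_mul_simpleTransposition {v : Equiv.Perm (Fin (n + 1))} (h : BruhatStep u v)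
    (p : Fin n) : v = u * simpleTransposition p ∨
      BruhatStep (u * simpleTransposition p) (v * simpleTransposition p) := by
  rw [bruhatStep_iff] at h
  obtain ⟨a, b, hab, hu, rfl⟩ := h
  by_cases h1 : a = u p.castSucc ∧ b = u p.succ
  · left
    rw [h1.1, h1.2, simpleTransposition, Equiv.swap_apply_apply]
    simp [mul_assoc]
  · right
    refine bruhatStep_iff.2 ⟨a, b, hab, (mul_simpleTransposition_lt_iff u p h1 ?_).2 hu,
      mul_assoc _ _ _⟩
    rintro ⟨rfl, rfl⟩
    exact hu.asymm (by simp [Above, Fin.lt_def])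

lemma bruhatLE_mul_simpleTransposition {v : Equiv.Perm (Fin (n + 1))} (h : BruhatLE u v)
    (p : Fin n) : BruhatLE (u * simpleTransposition p) v ∨
      BruhatLE (u * simpleTransposition p) (v * simpleTransposition p) := by
  induction h with
  | refl => exact Or.inr Relation.ReflTransGen.refl
  | tail _ h ih =>
    rcases ih with ih | ih
    · exact Or.inl (ih.tail h)
    · rcases bruhatStep_mul_simpleTransposition h p with rfl | h'
      · exact Or.inl ih
      · exact Or.inr (ih.tail h')

lemma bruhatStep_mul_of_lt {p : Fin n} (h : u p.castSucc < u p.succ) :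
    BruhatStep u (u * simpleTransposition p) := by
  refine bruhatStep_iff.2 ⟨_, _, h, ?_, ?_⟩
  · simp [Above, Fin.lt_def]
  · rw [simpleTransposition, Equiv.swap_apply_apply]
    simp [mul_assoc]

/-- The Bruhat maximum of the products of subwords exists. -/
lemma exists_demazure (Q : ℕ → Fin n) (m : ℕ) :
    ∃ X : Finset ℕ, ∀ Y : Finset ℕ, BruhatLE (pre Q Y m) (pre Q X m) := by
  induction m with
  | zero => exact ⟨∅, fun Y => Relation.ReflTransGen.refl⟩
  | succ m ih =>
    obtain ⟨X, hX⟩ := ih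
    have h1 : pre Q (insert m X) (m + 1) = pre Q X m := by
      rw [pre_succ_of_mem (Finset.mem_insert_self _ _)]
      exact pre_congr_right fun i hi => by simp [hi.ne]
    have h2 : pre Q (X.erase m) (m + 1) = pre Q X m * simpleTransposition (Q m) := by
      rw [pre_succ_of_notMem (Finset.notMem_erase _ _)]
      congr 1
      exact pre_congr_right fun i hi => by simp [hi.ne]
    have key : ∀ D, BruhatLE (pre Q X m) D → BruhatLE (pre Q X m * simpleTransposition (Q m)) D →
        ∀ Y, BruhatLE (pre Q Y (m + 1)) D := by
      intro D hD hD' Y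
      by_cases hY : m ∈ Y
      · rw [pre_succ_of_mem hY]
        exact (hX Y).trans hD
      · rw [pre_succ_of_notMem hY]
        rcases bruhatLE_mul_simpleTransposition (hX Y) (Q m) with h | h
        · exact h.trans hD
        · exact h.trans hD'
    rcases apply_castSucc_lt_or_gt (pre Q X m) (Q m) with h | h
    · refine ⟨X.erase m, key _ ?_ ?_⟩
      · rw [h2]; exact Relation.ReflTransGen.single (bruhatStep_mul_of_lt h)
      · rw [h2]; exact Relation.ReflTransGen.refl
    · refine ⟨insert m X, key _ ?_ ?_⟩
      · rw [h1]; exact Relation.ReflTransGen.refl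
      · rw [h1]
        have := bruhatStep_mul_of_lt (u := pre Q X m * simpleTransposition (Q m)) (p := Q m)
          (by simpa using h)
        rw [mul_assoc, simpleTransposition_mul_self, mul_one] at this
        exact Relation.ReflTransGen.single this

/-- By strong exchange, a Bruhat step downwards is realized by omitting one more letter. With
`exists_demazure`, lying below the Demazure product thus means being a product of a subword. -/
lemma exists_pre_eq_of_bruhatLE {v : Equiv.Perm (Fin (n + 1))} (h : BruhatLE u v)
    (hv : ∃ J, pre Q J m = v) : ∃ J, pre Q J m = u := by
  induction h with
  | refl => exact hv
  | tail _ h ih =>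
    apply ih
    obtain ⟨J, rfl⟩ := hv
    obtain ⟨a, b, hab, hu, hJ⟩ := bruhatStep_iff.1 h
    obtain ⟨k, hk, -, -, -, hpre, -⟩ := exists_pre_eq_swap_mul (Q := Q) (J := J) (m := m) hab (by
      rw [hJ, above_swap_mul, Equiv.swap_apply_left, Equiv.swap_apply_right]; exact hu)
    refine ⟨insert k J, ?_⟩
    rw [hpre, if_neg (by omega), hJ, ← mul_assoc, Equiv.swap_mul_self, one_mul]

/-- Every product of a subword is the product of a reduced subword. -/
lemma exists_facetN (Q : ℕ → Fin n) (J : Finset ℕ) (m : ℕ) :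
    ∃ K, FacetN Q m (pre Q J m) K := by
  induction m with
  | zero => exact ⟨∅, by simp, rfl, by simp⟩
  | succ m ih =>
    obtain ⟨K, hK⟩ := ih
    have hmK : m ∉ K := fun h => by simpa using hK.subset h
    have hins : ∀ L : Finset ℕ, L ⊆ Finset.range m →
        (Finset.range (m + 1) \ insert m L).card = (Finset.range m \ L).card := by
      intro L hL
      rw [card_range_succ_sdiff_of_mem (Finset.mem_insert_self _ _), Finset.sdiff_insert,
        Finset.erase_eq_of_notMem (by simp)]
    have hsub : ∀ L : Finset ℕ, L ⊆ Finset.range m → insert m L ⊆ Finset.range (m + 1) := by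
      intro L hL
      rw [Finset.range_add_one]
      exact Finset.insert_subset_insert _ hL
    have hpreins : ∀ L : Finset ℕ, pre Q (insert m L) (m + 1) = pre Q L m := by
      intro L
      rw [pre_succ_of_mem (Finset.mem_insert_self _ _)]
      exact pre_congr_right fun i hi => by simp [hi.ne]
    by_cases hm : m ∈ J
    · refine ⟨insert m K, hsub K hK.subset, ?_, ?_⟩
      · rw [hpreins, hK.pre_eq, pre_succ_of_mem hm]
      · rw [hins K hK.subset, hK.card_eq, pre_succ_of_mem hm]
    · rw [pre_succ_of_notMem hm]
      rcases apply_castSucc_lt_or_gt (pre Q J m) (Q m) with h | h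
      · refine ⟨K, hK.subset.trans (Finset.range_mono (Nat.le_succ m)), ?_, ?_⟩
        · rw [pre_succ_of_notMem hmK, hK.pre_eq]
        · rw [card_range_succ_sdiff_of_notMem hmK, hK.card_eq, card_inversions_mul_of_lt h]
      -- At a descent the last letter undoes an earlier crossing of the same two values, so both
      -- letters are omitted.
      · obtain ⟨k, hk, -, -, -, hpre, hcard⟩ := exists_pre_eq_swap_mul (Q := Q) (J := K) (m := m) h
          (by rw [hK.pre_eq]; simp [Above, Fin.lt_def])
        have hsubk : insert k K ⊆ Finset.range m :=
          Finset.insert_subset (Finset.mem_range.2 hk) hK.subset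
        refine ⟨insert m (insert k K), hsub _ hsubk, ?_, ?_⟩
        · rw [hpreins, hpre, if_neg (by omega), hK.pre_eq, simpleTransposition,
            Equiv.swap_comm, Equiv.swap_apply_apply]
          simp [mul_assoc]
        · have := card_inversions_mul_of_gt h
          rw [hins _ hsubk]
          rw [hK.card_eq] at hcard
          omega

/-! ### Cover roots as roots of facets. -/

lemma BruhatCovers.above (h : BruhatCovers w (Equiv.swap a b * w)) (hab : a < b) :
    Above w a b := by
  refine (above_or_above w hab.ne).resolve_right fun h' => ?_
  have h1 := card_inversions_lt_swap_mul (u := Equiv.swap a b * w) hab (by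
    rw [above_swap_mul, Equiv.swap_apply_left, Equiv.swap_apply_right]; exact h')
  rw [← mul_assoc, Equiv.swap_mul_self, one_mul] at h1
  exact h1.not_ge h.1.1.card_le

/-- With `x` between `a` and `b` both in value and in position, the step factors through the chain
`w < (a x) w < (a b)(a x) w < (a b) w`. -/
lemma not_bruhatCovers_of_between {x : Fin (n + 1)} (hax : a < x) (hxb : x < b)
    (h : Above w a x) (h' : Above w x b) : ¬ BruhatCovers w (Equiv.swap a b * w) := by
  intro hcov
  have h1 : BruhatStep w (Equiv.swap a x * w) := bruhatStep_iff.2 ⟨a, x, hax, h, rfl⟩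
  have h2 : BruhatStep (Equiv.swap a x * w) (Equiv.swap a b * (Equiv.swap a x * w)) := by
    refine bruhatStep_iff.2 ⟨a, b, hax.trans hxb, ?_, rfl⟩
    rw [above_swap_mul, Equiv.swap_apply_left,
      Equiv.swap_apply_of_ne_of_ne (hax.trans hxb).ne' hxb.ne']
    exact h'
  have h3 : BruhatStep (Equiv.swap a b * (Equiv.swap a x * w)) (Equiv.swap a b * w) := by
    refine bruhatStep_iff.2 ⟨x, b, hxb, ?_, ?_⟩
    · rw [above_swap_mul, above_swap_mul, Equiv.swap_apply_right, Equiv.swap_apply_left,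
        Equiv.swap_apply_of_ne_of_ne hax.ne' hxb.ne, Equiv.swap_apply_right]
      exact h
    · have := Equiv.swap_mul_swap_mul_swap (x := x) (y := a) (z := b) hax.ne' hxb.ne
      rw [Equiv.swap_comm x a] at this
      have h4 : Equiv.swap a b * Equiv.swap a x = Equiv.swap b x * Equiv.swap a b := by
        rw [← this, mul_assoc, mul_assoc, Equiv.swap_mul_self, mul_one]
      rw [← mul_assoc, ← mul_assoc, mul_assoc (Equiv.swap x b), h4, Equiv.swap_comm b x,
        ← mul_assoc, Equiv.swap_mul_self, one_mul]
  refine hcov.2 ⟨_, ⟨Relation.ReflTransGen.single h1, fun h => ?_⟩,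
    ⟨(Relation.ReflTransGen.single h2).tail h3, fun h => ?_⟩⟩
  · have := h1.card_lt
    rw [← h] at this
    exact lt_irrefl _ this
  · have := h2.card_lt.trans h3.card_lt
    rw [← h] at this
    exact lt_irrefl _ this

/-- The two values at a letter are in adjacent positions, so no third value stands between them. -/
lemma above_of_above_upper {c : Fin (n + 1)} (h : Above (pre Q J k) (upper Q J k) c)
    (hc : c ≠ lower Q J k) : Above (pre Q J k) (lower Q J k) c := by
  have hne : (pre Q J k)⁻¹ c ≠ (Q k).succ := fun h' => hc (by
    rw [lower, ← h']; simp)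
  simp only [Above, upper, lower, Equiv.Perm.inv_def, Equiv.symm_apply_apply] at h hne ⊢
  rw [Fin.lt_def] at h ⊢
  rw [Ne, Fin.ext_iff] at hne
  simp only [Fin.val_castSucc, Fin.val_succ] at *
  omega

lemma above_of_above_lower {c : Fin (n + 1)} (h : Above (pre Q J k) c (lower Q J k))
    (hc : c ≠ upper Q J k) : Above (pre Q J k) c (upper Q J k) := by
  have hne : (pre Q J k)⁻¹ c ≠ (Q k).castSucc := fun h' => hc (by
    rw [upper, ← h']; simp)
  simp only [Above, upper, lower, Equiv.Perm.inv_def, Equiv.symm_apply_apply] at h hne ⊢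
  rw [Fin.lt_def] at h ⊢
  rw [Ne, Fin.ext_iff] at hne
  simp only [Fin.val_castSucc, Fin.val_succ] at *
  omega

/-- A cover root is the root of some facet of `w`, obtained by omitting one letter of a reduced
subword for the cover. -/
lemma exists_facet_of_bruhatCovers (hab : a < b) (hcov : BruhatCovers w (Equiv.swap a b * w))
    (hK : FacetN Q m (Equiv.swap a b * w) J) :
    ∃ J₀ k, FacetN Q m w J₀ ∧ k ∈ J₀ ∧ upper Q J₀ k = a ∧ lower Q J₀ k = b := by
  have hw := hcov.above hab
  obtain ⟨k, hkm, hkJ, hu, hl, hpre, hcard⟩ := exists_pre_eq_swap_mul (Q := Q) (J := J) (m := m) hab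
    (by rw [hK.pre_eq, above_swap_mul, Equiv.swap_apply_left, Equiv.swap_apply_right]; exact hw)
  have hprek : pre Q (insert k J) k = pre Q J k := by rw [hpre, if_pos le_rfl]
  refine ⟨insert k J, k, ?_, Finset.mem_insert_self _ _, by rw [upper, hprek]; exact hu,
    by rw [lower, hprek]; exact hl⟩
  refine facetN_of_upper_lt_lower (Finset.insert_subset (Finset.mem_range.2 hkm) hK.subset) ?_ ?_
  · rw [hpre, if_neg (by omega), hK.pre_eq, ← mul_assoc, Equiv.swap_mul_self, one_mul]
  intro l hlm hlJ
  rw [Finset.mem_insert, not_or] at hlJ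
  have hlt := hK.upper_lt_lower hlm hlJ.2
  rcases lt_or_gt_of_ne hlJ.1 with hlk | hlk
  · rw [upper, lower, hpre, if_pos hlk.le]
    exact hlt
  -- Omitting `k` reflects the later roots in `e_a - e_b`. A positive root could become negative
  -- only through a value `x` strictly between `a` and `b`, which would also stand between them in
  -- position, contradicting the cover.
  have hbetween : ∀ x, a < x → x < b → Above (Equiv.swap a b * w) b x →
      Above (Equiv.swap a b * w) x a → False := by
    intro x h1 h2 h3 h4
    rw [above_swap_mul, Equiv.swap_apply_of_ne_of_ne h1.ne' h2.ne] at h3 h4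
    rw [Equiv.swap_apply_right] at h3
    rw [Equiv.swap_apply_left] at h4
    exact not_bruhatCovers_of_between h1 h2 h3 h4 hcov
  have hfinal := hK.above_of_crossing_lt hlm hlJ.2 hlm le_rfl
  have hearly := hK.above_of_le_crossing hlm hlJ.2 hlk.le
  have hl' := hK.above_of_crossing_lt hkm hkJ hlk hlm.le
  rw [hu, hl] at hl'
  have hul := above_upper_lower (Q := Q) (J := J) (k := l)
  rw [hK.pre_eq] at hfinal
  have h1 : upper Q (insert k J) l = Equiv.swap a b (upper Q J l) := by
    rw [upper, hpre, if_neg (by omega)]; rfl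
  have h2 : lower Q (insert k J) l = Equiv.swap a b (lower Q J l) := by
    rw [lower, hpre, if_neg (by omega)]; rfl
  rw [h1, h2]
  generalize upper Q J l = c at *
  generalize lower Q J l = d at *
  by_cases hca : c = a
  · subst hca
    have hdb : d ≠ b := by rintro rfl; exact hul.asymm hl'
    rw [Equiv.swap_apply_left, Equiv.swap_apply_of_ne_of_ne hlt.ne' hdb]
    by_contra hcon
    have hdlt : d < b := lt_of_le_of_ne (not_lt.1 hcon) hdb
    have h3 := above_of_above_upper (Q := Q) (J := J) (k := k) (c := d) (by rwa [hu]) (by rwa [hl])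
    rw [hl] at h3
    have h4 := hK.above_mono hdlt hkm.le le_rfl h3
    rw [hK.pre_eq] at h4
    exact hbetween d hlt hdlt h4 hfinal
  by_cases hcb : c = b
  · subst hcb
    rw [Equiv.swap_apply_right, Equiv.swap_apply_of_ne_of_ne (hab.trans hlt).ne' hlt.ne']
    exact hab.trans hlt
  rw [Equiv.swap_apply_of_ne_of_ne hca hcb]
  by_cases hda : d = a
  · subst hda
    rw [Equiv.swap_apply_left]
    exact hlt.trans hab
  by_cases hdb : d = b
  · subst hdb
    rw [Equiv.swap_apply_right]
    by_contra hcon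
    have hclt : a < c := lt_of_le_of_ne (not_lt.1 hcon) (Ne.symm hca)
    have h3 := above_of_above_lower (Q := Q) (J := J) (k := k) (c := c) (by rwa [hl]) (by rwa [hu])
    rw [hu] at h3
    have h4 := hK.above_mono hclt hkm.le le_rfl h3
    rw [hK.pre_eq] at h4
    exact hbetween c hclt hlt hfinal h4
  · rwa [Equiv.swap_apply_of_ne_of_ne hda hdb]

/-- A functional that is nonpositive on the roots of a facet is nonpositive on the cover roots. -/
lemma LocOpt.le_of_bruhatCovers {v : Fin (n + 1) → ℝ} (h : LocOpt Q ∅ J v) (hJ : FacetN Q m w J)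
    (hab : a < b) (hcov : BruhatCovers w (Equiv.swap a b * w))
    (hsub : ∃ K, pre Q K m = Equiv.swap a b * w) : v a ≤ v b := by
  obtain ⟨K, hK⟩ := hsub
  obtain ⟨K', hK'⟩ := exists_facetN Q K m
  rw [hK] at hK'
  obtain ⟨J₀, k, hJ₀, hk, hu, hl⟩ := exists_facet_of_bruhatCovers hab hcov hK'
  obtain ⟨Q', m', w', hm, hQ, hw, hF⟩ := exists_extension Q m w
  have hkm : k < m := Finset.mem_range.1 (hJ₀.subset hk)
  have hroot : ∀ l < m, upper Q' J₀ l = upper Q J₀ l ∧ lower Q' J₀ l = lower Q J₀ l := by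
    intro l hl
    rw [upper, upper, lower, lower, pre_congr fun i hi => hQ i (by omega), hQ l hl]
    exact ⟨rfl, rfl⟩
  have hu' : upper Q' J₀ k = a := (hroot k hkm).1.trans hu
  have hl' : lower Q' J₀ k = b := (hroot k hkm).2.trans hl
  obtain ⟨k', J₁, lo, hi, hf⟩ := (hF J₀ hJ₀).exists_flip hk (by rw [hu', hl']; exact hw a b hab)
  -- `w` does not invert `a` and `b`, so they can cross only at an appended letter.
  have hk' : m ≤ k' := by
    by_contra hcon
    rw [not_le] at hcon
    have hp := hf.pair
    rw [hu', hl', IsPairAt, (hroot k' hcon).1, (hroot k' hcon).2] at hp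
    obtain ⟨h1, h2⟩ := hJ₀.pair_crossing_lt hab hcon hf.k_notMem hp
    have h3 := hJ₀.above_of_crossing_lt hcon hf.k_notMem hcon le_rfl
    rw [h1, h2, hJ₀.pre_eq] at h3
    exact h3.asymm (hcov.above hab)
  obtain ⟨rfl, rfl⟩ : lo = k ∧ hi = k' := by
    refine hf.ends.resolve_right fun h' => ?_
    have := hf.lt
    omega
  -- Beyond the original word `J` and `J₀` have the same prefixes. Comparing `J` with the flip of
  -- `J₀` at `hi` therefore leaves exactly `0 ≤ v b - v a`.
  have h1 := wsum_le_of_locOpt (hF J hJ) hf.facet (Finset.empty_subset _) (Finset.empty_subset _)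
    (h.congr hJ.subset hQ) hf.hi_lt.le (Q' hi).castSucc
  have h2 : pre Q' J hi = pre Q' J₀ hi := by
    refine pre_eq_of_eq_of_le hJ.subset hJ₀.subset ?_ hk'
    rw [pre_congr hQ, pre_congr hQ, hJ.pre_eq, hJ₀.pre_eq]
  rw [hf.wsum_hi, h2, hu', hl'] at h1
  linarith

/-- A root of a facet that cannot be flipped is a cover root. -/
lemma FacetN.bruhatCovers_of_not_inverted (hJ : FacetN Q m w J) {j : ℕ} (hj : j ∈ J)
    (h : ¬ Inverted w (upper Q J j) (lower Q J j)) :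
    upper Q J j < lower Q J j ∧
      BruhatCovers w (Equiv.swap (upper Q J j) (lower Q J j) * w) ∧
      ∃ K, pre Q K m = Equiv.swap (upper Q J j) (lower Q J j) * w := by
  have hjm := Finset.mem_range.1 (hJ.subset hj)
  have hlt : upper Q J j < lower Q J j := by
    refine (lt_or_gt_of_ne upper_ne_lower).resolve_right fun h' => h (Or.inr ⟨h', ?_⟩)
    have := hJ.above_mono h' hjm.le le_rfl above_upper_lower
    rwa [hJ.pre_eq] at this
  have hw : Above w (upper Q J j) (lower Q J j) :=
    (above_or_above w hlt.ne).resolve_right fun h' => h (Or.inl ⟨hlt, h'⟩)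
  have hpre := pre_toggle (Q := Q) (J := J) (J' := J.erase j) (x := j)
    (fun i hi => by simp [hi]) (by simp [hj]) m
  rw [if_neg (by omega), hJ.pre_eq] at hpre
  -- Using the letter `j` as well costs one letter, so the length grows by at most one, which leaves
  -- no room for an intermediate element.
  have hcard : (inversions (Equiv.swap (upper Q J j) (lower Q J j) * w)).card ≤
      (inversions w).card + 1 := by
    rw [← hpre, ← hJ.card_eq]
    refine (card_inversions_pre Q (J.erase j) m).1.trans ?_
    rw [Finset.sdiff_erase (Finset.mem_range.2 hjm)]
    exact Finset.card_insert_le _ _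
  have hstep : BruhatStep w (Equiv.swap (upper Q J j) (lower Q J j) * w) :=
    bruhatStep_iff.2 ⟨_, _, hlt, hw, rfl⟩
  refine ⟨hlt, ⟨⟨Relation.ReflTransGen.single hstep, fun h' => ?_⟩, ?_⟩, _, hpre⟩
  · have := hstep.card_lt
    rw [← h'] at this
    exact lt_irrefl _ this
  · have hstrict : ∀ {x y : Equiv.Perm (Fin (n + 1))}, BruhatLT x y →
        (inversions x).card < (inversions y).card := by
      rintro x y ⟨hle, hne⟩
      rcases Relation.ReflTransGen.cases_head hle with rfl | ⟨z, hz, hzy⟩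
      · exact absurd rfl hne
      · exact hz.card_lt.trans_le (BruhatLE.card_le hzy)
    rintro ⟨x, h1, h2⟩
    have := hstrict h1
    have := hstrict h2
    omega

end Bruhat

/-! ## Words on `Fin m` -/

section FiniteWords

variable {n m : ℕ} {Q : Fin m → Fin n} {Q' : ℕ → Fin n} {w : Equiv.Perm (Fin (n + 1))}

/-- The positions in `J`, as natural numbers. -/
def positions (J : Finset (Fin m)) : Finset ℕ := J.map Fin.valEmbedding

@[simp] lemma mem_positions {J : Finset (Fin m)} {k : Fin m} : (k : ℕ) ∈ positions J ↔ k ∈ J := by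
  simp [positions, Fin.val_inj]

lemma positions_subset_range (J : Finset (Fin m)) : positions J ⊆ Finset.range m := by
  intro i hi
  obtain ⟨k, -, rfl⟩ := Finset.mem_map.1 hi
  simp

lemma positions_subset_iff {I J : Finset (Fin m)} : positions I ⊆ positions J ↔ I ⊆ J :=
  Finset.map_subset_map

lemma exists_positions_eq {K : Finset ℕ} (hK : K ⊆ Finset.range m) :
    ∃ J : Finset (Fin m), positions J = K := by
  refine ⟨Finset.univ.filter fun i : Fin m => (i : ℕ) ∈ K, ?_⟩
  ext i
  simp only [positions, Finset.mem_map, Finset.mem_filter, Finset.mem_univ, true_and,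
    Fin.valEmbedding_apply]
  constructor
  · rintro ⟨k, hk, rfl⟩; exact hk
  · intro hi; exact ⟨⟨i, Finset.mem_range.1 (hK hi)⟩, hi, rfl⟩

lemma pre_eq_prod (Q' : ℕ → Fin n) (K : Finset ℕ) (k : ℕ) :
    pre Q' K k =
      ((List.range k).map fun i => if i ∈ K then 1 else simpleTransposition (Q' i)).prod := by
  induction k with
  | zero => rfl
  | succ k ih =>
    rw [List.range_succ, List.map_append, List.prod_append, ← ih, pre]
    split_ifs with h <;> simp [h]

lemma wordProd_subword (hQ : ∀ k : Fin m, Q' k = Q k) {X : Finset (Fin m)} {K : Finset ℕ}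
    (h : ∀ k : Fin m, k ∈ X ↔ (k : ℕ) ∉ K) : wordProd (subword Q X) = pre Q' K m := by
  have hlist : ∀ l : List (Fin m), wordProd ((l.filter (fun k => k ∈ X)).map Q) =
      ((l.map Fin.val).map fun i => if i ∈ K then 1 else simpleTransposition (Q' i)).prod := by
    intro l
    induction l with
    | nil => rfl
    | cons k l ih =>
      by_cases hk : k ∈ X
      · have hk' := (h k).1 hk
        rw [List.filter_cons_of_pos (by simpa using hk), List.map_cons, List.map_cons,
          List.map_cons, List.prod_cons, ← ih, if_neg hk', hQ]
        simp [wordProd]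
      · have hk' : (k : ℕ) ∈ K := not_not.1 fun h' => hk ((h k).2 h')
        rw [List.filter_cons_of_neg (by simpa using hk), List.map_cons, List.map_cons,
          List.prod_cons, ← ih, if_pos hk', one_mul]
  rw [subword, hlist, pre_eq_prod, List.map_coe_finRange_eq_range]

lemma length_subword (Q : Fin m → Fin n) (X : Finset (Fin m)) : (subword Q X).length = X.card := by
  rw [subword, List.length_map, ← List.toFinset_card_of_nodup ((List.nodup_finRange m).filter _)]
  congr 1
  ext k
  simp

lemma isFacet_iff (hQ : ∀ k : Fin m, Q' k = Q k) {J : Finset (Fin m)} :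
    IsFacet Q w J ↔ FacetN Q' m w (positions J) := by
  rw [IsFacet, isReducedExpression_iff, length_subword,
    wordProd_subword hQ (K := positions J) (by simp)]
  have hcard : (Finset.range m \ positions J).card = Jᶜ.card := by
    rw [Finset.card_sdiff_of_subset (positions_subset_range J), Finset.card_compl, positions,
      Finset.card_map]
    simp
  constructor
  · rintro ⟨h1, h2⟩
    exact ⟨positions_subset_range J, h1, hcard.trans h2⟩
  · intro h
    exact ⟨h.pre_eq, hcard.symm.trans h.card_eq⟩

lemma prefixProd_eq (hQ : ∀ k : Fin m, Q' k = Q k) (J : Finset (Fin m)) (k : Fin m) :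
    prefixProd Q J k = pre Q' (positions J) k := by
  -- The prefix product is the product of the whole word with all positions from `k` on omitted.
  have hconst : ∀ l, (k : ℕ) ≤ l → l ≤ m →
      pre Q' (positions J ∪ Finset.Ico (k : ℕ) m) l = pre Q' (positions J) k := by
    intro l hl
    induction l, hl using Nat.le_induction with
    | base =>
      intro _
      refine pre_congr_right fun i hi => ?_
      simp only [Finset.mem_union, Finset.mem_Ico, or_iff_left_iff_imp]
      exact fun h => absurd h.1 hi.not_ge
    | succ l hl ih =>
      intro hlm
      rw [pre_succ_of_mem, ih (by omega)]
      exact Finset.mem_union_right _ (Finset.mem_Ico.2 ⟨hl, hlm⟩)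
  rw [prefixProd, ← hconst m k.isLt.le le_rfl]
  apply wordProd_subword hQ
  intro i
  simp only [Finset.mem_filter, Finset.mem_univ, true_and, Finset.mem_union, mem_positions,
    Finset.mem_Ico, Fin.lt_def]
  have := i.isLt
  constructor
  · rintro ⟨h1, h2⟩ (h3 | h3)
    · exact h2 h3
    · omega
  · intro h
    exact ⟨by by_contra h'; exact h (Or.inr (by omega)), fun h' => h (Or.inl h')⟩

lemma permAct_single (σ : Equiv.Perm (Fin (n + 1))) (i : Fin (n + 1)) :
    permAct σ (Pi.single i 1) = Pi.single (σ i) 1 := by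
  ext j
  simp only [permAct, Pi.single_apply, Equiv.Perm.inv_eq_iff_eq]

lemma rootFunction_eq (hQ : ∀ k : Fin m, Q' k = Q k) (J : Finset (Fin m)) (k : Fin m) :
    rootFunction Q J k = root (upper Q' (positions J) k) (lower Q' (positions J) k) := by
  have : ∀ (σ : Equiv.Perm (Fin (n + 1))) (i j : Fin (n + 1)),
      permAct σ (root i j) = root (σ i) (σ j) := by
    intro σ i j
    rw [root, root, ← permAct_single, ← permAct_single]
    rfl
  rw [rootFunction, prefixProd_eq hQ, simpleRoot, this, upper, lower, hQ]

lemma weightFunction_eq (hQ : ∀ k : Fin m, Q' k = Q k) (J : Finset (Fin m)) (k : Fin m) :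
    weightFunction Q J k = wsum (fun i => (Pi.single i 1 : Fin (n + 1) → ℝ))
      (pre Q' (positions J) k) (Q' k).castSucc := by
  rw [weightFunction, prefixProd_eq hQ, fundamentalWeight, wsum, hQ]
  have : ∀ (σ : Equiv.Perm (Fin (n + 1))) (s : Finset (Fin (n + 1)))
      (g : Fin (n + 1) → Fin (n + 1) → ℝ), permAct σ (∑ q ∈ s, g q) = ∑ q ∈ s, permAct σ (g q) := by
    intro σ s g
    ext i
    simp [permAct, Finset.sum_apply]
  rw [this]
  refine Finset.sum_congr (by ext; simp) fun q _ => permAct_single _ _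

lemma brickVector_eq (hQ : ∀ k : Fin m, Q' k = Q k) (J : Finset (Fin m)) :
    brickVector Q J =
      -weightTotal Q' m (fun i => (Pi.single i 1 : Fin (n + 1) → ℝ)) (positions J) := by
  rw [brickVector, weightTotal, Finset.sum_range]
  simp only [weightFunction_eq hQ]

lemma map_brickVector (hQ : ∀ k : Fin m, Q' k = Q k) (J : Finset (Fin m))
    (f : (Fin (n + 1) → ℝ) →ₗ[ℝ] ℝ) : f (brickVector Q J) =
      -weightTotal Q' m (fun i => f (Pi.single i 1)) (positions J) := by
  rw [brickVector_eq hQ, map_neg]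
  simp only [weightTotal, wsum, map_sum]

lemma map_root (f : (Fin (n + 1) → ℝ) →ₗ[ℝ] ℝ) (i j : Fin (n + 1)) :
    f (root i j) = f (Pi.single i 1) - f (Pi.single j 1) := map_sub f _ _

lemma isDemazureProduct_demazureProduct (hQ : ∀ k : Fin m, Q' k = Q k) :
    IsDemazureProduct Q (demazureProduct Q) := by
  apply Classical.epsilon_spec (p := IsDemazureProduct Q)
  obtain ⟨X, hX⟩ := exists_demazure Q' m
  refine ⟨pre Q' X m, ⟨Finset.univ.filter fun i : Fin m => (i : ℕ) ∉ X, ?_⟩, fun Y => ?_⟩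
  · exact wordProd_subword hQ (by simp)
  · rw [wordProd_subword hQ (K := positions Yᶜ) (by simp)]
    exact hX _

lemma bruhatLE_demazureProduct_iff (hQ : ∀ k : Fin m, Q' k = Q k)
    (u : Equiv.Perm (Fin (n + 1))) :
    BruhatLE u (demazureProduct Q) ↔ ∃ K, pre Q' K m = u := by
  obtain ⟨⟨X, hX⟩, hmax⟩ := isDemazureProduct_demazureProduct hQ
  constructor
  · intro h
    refine exists_pre_eq_of_bruhatLE h ⟨positions Xᶜ, ?_⟩
    rw [← hX, ← wordProd_subword hQ]
    simp
  · rintro ⟨K, rfl⟩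
    rw [← wordProd_subword hQ (X := Finset.univ.filter fun i : Fin m => (i : ℕ) ∉ K) (by simp)]
    exact hmax _

/-- The generators of the Bruhat cone. -/
def coverRoots (Q : Fin m → Fin n) (w : Equiv.Perm (Fin (n + 1))) : Set (Fin (n + 1) → ℝ) :=
  {β | ∃ i j : Fin (n + 1), i < j ∧ β = root i j ∧ BruhatCovers w (Equiv.swap i j * w) ∧
    BruhatLE (Equiv.swap i j * w) (demazureProduct Q)}

lemma finite_coverRoots (Q : Fin m → Fin n) (w : Equiv.Perm (Fin (n + 1))) :
    (coverRoots Q w).Finite := by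
  refine (Set.finite_range fun x : Fin (n + 1) × Fin (n + 1) => root x.1 x.2).subset ?_
  rintro β ⟨i, j, -, rfl, -⟩
  exact ⟨(i, j), rfl⟩

/-- Either `n = 0` and there are no letters, or the word extends to the natural numbers. -/
lemma isEmpty_or_exists_extension (Q : Fin m → Fin n) :
    (n = 0 ∧ IsEmpty (Fin m)) ∨ ∃ Q' : ℕ → Fin n, ∀ k : Fin m, Q' k = Q k := by
  rcases n with _ | n
  · exact Or.inl ⟨rfl, ⟨fun k => (Q k).elim0⟩⟩
  · exact Or.inr ⟨fun k => if h : k < m then Q ⟨k, h⟩ else 0, fun k => by simp⟩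

/-! ### Roots, flips and functionals for words on `Fin m`. -/

variable {I J J' : Finset (Fin m)} {f : (Fin (n + 1) → ℝ) →ₗ[ℝ] ℝ}

/-- At every position of a facet, there is either a flip or a cover root. -/
lemma IsFacet.flip_or_mem_coverRoots (hJ : IsFacet Q w J) {j : Fin m} (hj : j ∈ J) :
    (∃ J', IsFacet Q w J' ∧ (∀ I : Finset (Fin m), I ⊆ J → j ∉ I → I ⊆ J') ∧
      ∃ c : ℝ, 0 < c ∧ brickVector Q J' = brickVector Q J + c • rootFunction Q J j) ∨
    rootFunction Q J j ∈ coverRoots Q w := by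
  rcases isEmpty_or_exists_extension Q with ⟨-, h⟩ | ⟨Q', hQ⟩
  · exact h.elim j
  have hJ' := (isFacet_iff hQ).1 hJ
  have hj' : (j : ℕ) ∈ positions J := mem_positions.2 hj
  by_cases hinv : Inverted w (upper Q' (positions J) j) (lower Q' (positions J) j)
  · left
    obtain ⟨k, K, lo, hi, hf⟩ := hJ'.exists_flip hj' hinv
    obtain ⟨J', rfl⟩ := exists_positions_eq hf.facet.subset
    obtain ⟨c, hc, hw⟩ := hf.weightTotal_eq
    refine ⟨J', (isFacet_iff hQ).2 hf.facet, fun I hI hjI => ?_, c, by exact_mod_cast hc, ?_⟩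
    · exact positions_subset_iff.1 (hf.subset (positions_subset_iff.2 hI) (by simpa using hjI))
    · rw [brickVector_eq hQ, brickVector_eq hQ, hw, rootFunction_eq hQ, root,
        Nat.cast_smul_eq_nsmul, smul_sub, smul_sub]
      abel
  · right
    obtain ⟨h1, h2, h3⟩ := hJ'.bruhatCovers_of_not_inverted hj' hinv
    exact ⟨_, _, h1, rootFunction_eq hQ J j, h2, (bruhatLE_demazureProduct_iff hQ _).2 h3⟩

lemma locOpt_of_rootFunction_nonpos (hQ : ∀ k : Fin m, Q' k = Q k)
    (h : ∀ j ∈ J, j ∉ I → f (rootFunction Q J j) ≤ 0) :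
    LocOpt Q' (positions I) (positions J) (fun i => f (Pi.single i 1)) := by
  intro j hj hjI
  obtain ⟨j, -, rfl⟩ := Finset.mem_map.1 hj
  have := h j (mem_positions.1 hj) (mt mem_positions.2 hjI)
  rw [rootFunction_eq hQ, map_root] at this
  exact sub_nonpos.1 this

lemma IsFacet.brickVector_le (hJ : IsFacet Q w J) (hJ' : IsFacet Q w J') (hI : I ⊆ J)
    (hI' : I ⊆ J') (h : ∀ j ∈ J, j ∉ I → f (rootFunction Q J j) ≤ 0) :
    f (brickVector Q J') ≤ f (brickVector Q J) := by
  rcases isEmpty_or_exists_extension Q with ⟨-, h⟩ | ⟨Q', hQ⟩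
  · rw [Subsingleton.elim J J']
  rw [map_brickVector hQ, map_brickVector hQ, neg_le_neg_iff]
  exact Finset.sum_le_sum fun l hl => wsum_le_of_locOpt ((isFacet_iff hQ).1 hJ)
    ((isFacet_iff hQ).1 hJ') (positions_subset_iff.2 hI) (positions_subset_iff.2 hI')
    (locOpt_of_rootFunction_nonpos hQ h) (Finset.mem_range.1 hl).le _

lemma IsFacet.coverRoots_nonpos (hJ : IsFacet Q w J)
    (h : ∀ j ∈ J, f (rootFunction Q J j) ≤ 0) {β : Fin (n + 1) → ℝ} (hβ : β ∈ coverRoots Q w) :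
    f β ≤ 0 := by
  obtain ⟨a, b, hab, rfl, hcov, hle⟩ := hβ
  rcases isEmpty_or_exists_extension Q with ⟨rfl, -⟩ | ⟨Q', hQ⟩
  · have := b.isLt
    exact absurd hab (by rw [Fin.lt_def]; omega)
  rw [map_root, sub_nonpos]
  exact LocOpt.le_of_bruhatCovers (locOpt_of_rootFunction_nonpos (I := ∅) hQ fun j hj _ => h j hj)
    ((isFacet_iff hQ).1 hJ) hab hcov ((bruhatLE_demazureProduct_iff hQ _).1 hle)

/-- The weights of `J` are minimal term by term, so equality of the totals is equality of each
weight, and `f` cannot distinguish the prefixes of the two facets. -/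
lemma IsFacet.rootFunction_eq_of_le (hJ : IsFacet Q w J) (hJ' : IsFacet Q w J') (hI : I ⊆ J)
    (hI' : I ⊆ J') (h : ∀ j ∈ J, j ∉ I → f (rootFunction Q J j) ≤ 0)
    (heq : f (brickVector Q J) ≤ f (brickVector Q J')) :
    (∀ k, f (rootFunction Q J' k) = f (rootFunction Q J k)) ∧
      ∀ j ∈ J, f (rootFunction Q J j) ≠ 0 → j ∈ J' := by
  rcases isEmpty_or_exists_extension Q with ⟨-, h⟩ | ⟨Q', hQ⟩
  · exact ⟨fun k => h.elim k, fun j => h.elim j⟩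
  rw [map_brickVector hQ, map_brickVector hQ, neg_le_neg_iff] at heq
  have key := fun (l : ℕ) (hl : l ≤ m) x => (locOpt_of_rootFunction_nonpos hQ h).comp_pre_eq
    ((isFacet_iff hQ).1 hJ) ((isFacet_iff hQ).1 hJ') (positions_subset_iff.2 hI)
    (positions_subset_iff.2 hI') heq hl x
  constructor
  · intro k
    rw [rootFunction_eq hQ, rootFunction_eq hQ, map_root, map_root, upper, upper, lower, lower,
      key k k.isLt.le, key k k.isLt.le]
  · intro j hj hne
    rw [rootFunction_eq hQ, map_root, sub_ne_zero] at hne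
    exact mem_positions.1 (mem_of_comp_pre_eq
      (v := fun i => f (Pi.single i 1)) key j.isLt (mem_positions.2 hj) hne)

end FiniteWords

/-! ## Faces of convex hulls and cones -/

section Convex

variable {E : Type*} [AddCommGroup E] [Module ℝ E]

lemma smul_mem_hull {S : Set E} {x : E} (hx : x ∈ PointedCone.hull ℝ S) {c : ℝ} (hc : 0 ≤ c) :
    c • x ∈ PointedCone.hull ℝ S :=
  Submodule.smul_mem _ (⟨c, hc⟩ : {c : ℝ // 0 ≤ c}) hx

/-- A sum of nonpositive terms vanishes only if each term does; the second clause thus describes the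
face of the cone cut out by `f = 0`. -/
lemma nonpos_of_mem_hull {S : Set E} {f : E →ₗ[ℝ] ℝ} (hf : ∀ s ∈ S, f s ≤ 0) {x : E}
    (hx : x ∈ PointedCone.hull ℝ S) :
    f x ≤ 0 ∧ (f x = 0 → x ∈ PointedCone.hull ℝ {s ∈ S | f s = 0}) := by
  induction hx using Submodule.span_induction with
  | mem s hs => exact ⟨hf s hs, fun h => Submodule.subset_span ⟨hs, h⟩⟩
  | zero => exact ⟨by simp, fun _ => Submodule.zero_mem _⟩
  | add x y _ _ hx hy =>
    rw [map_add]
    exact ⟨add_nonpos hx.1 hy.1, fun h =>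
      Submodule.add_mem _ (hx.2 (by linarith [hx.1, hy.1])) (hy.2 (by linarith [hx.1, hy.1]))⟩
  | smul c x _ hx =>
    have h1 : f (c • x) = (c : ℝ) * f x := map_smul f (c : ℝ) x
    rw [h1]
    refine ⟨mul_nonpos_of_nonneg_of_nonpos c.2 hx.1, fun h => ?_⟩
    rcases mul_eq_zero.1 h with h | h
    · have : c = 0 := Subtype.ext h
      rw [this, zero_smul]
      exact Submodule.zero_mem _
    · exact Submodule.smul_mem _ c (hx.2 h)

/-- Farkas' lemma for finitely generated cones. -/
lemma mem_hull_or_exists_separating {ι : Type*} (t : Finset ι) (a : ι → E) (x : E) :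
    x ∈ PointedCone.hull ℝ (a '' t) ∨ ∃ f : E →ₗ[ℝ] ℝ, (∀ i ∈ t, f (a i) ≤ 0) ∧ 0 < f x := by
  classical
  induction t using Finset.induction_on generalizing a x with
  | empty =>
    by_cases hx : x = 0
    · left; rw [hx]; exact Submodule.zero_mem _
    · right
      have := mt (Module.forall_dual_apply_eq_zero_iff ℝ x).1 hx
      push Not at this
      obtain ⟨f, hf⟩ := this
      rcases lt_or_gt_of_ne hf with h | h
      · exact ⟨-f, by simp, by simpa using h⟩
      · exact ⟨f, by simp, h⟩
  | insert i t hi ih =>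
    have hmono : PointedCone.hull ℝ (a '' t) ≤ PointedCone.hull ℝ (a '' (insert i t : Finset ι)) :=
      Submodule.span_mono (Set.image_mono (by simp))
    rcases ih a x with h | ⟨f, hf, hfx⟩
    · exact Or.inl (hmono h)
    by_cases hfi : f (a i) ≤ 0
    · refine Or.inr ⟨f, fun k hk => ?_, hfx⟩
      rcases Finset.mem_insert.1 hk with rfl | hk
      · exact hfi
      · exact hf k hk
    rw [not_le] at hfi
    -- The projection along `a i` onto the kernel of `f` eliminates the new generator. A separating
    -- functional for the projected problem pulls back to one that vanishes on `a i`.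
    set P : E →ₗ[ℝ] E := LinearMap.id - (f.smulRight ((f (a i))⁻¹ • a i)) with hP
    have hPy : ∀ y, P y = y - (f y * (f (a i))⁻¹) • a i := fun y => by
      simp [hP, smul_smul]
    have hPi : P (a i) = 0 := by rw [hPy, mul_inv_cancel₀ hfi.ne', one_smul, sub_self]
    rcases ih (P ∘ a) (P x) with h | ⟨g, hg, hgx⟩
    · left
      have hpull : ∀ z ∈ PointedCone.hull ℝ ((P ∘ a) '' t),
          ∃ y ∈ PointedCone.hull ℝ (a '' t), P y = z := by
        intro z hz
        induction hz using Submodule.span_induction with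
        | mem z hz =>
          obtain ⟨k, hk, rfl⟩ := hz
          exact ⟨a k, Submodule.subset_span ⟨k, hk, rfl⟩, rfl⟩
        | zero => exact ⟨0, Submodule.zero_mem _, map_zero _⟩
        | add z z' _ _ hz hz' =>
          obtain ⟨y, hy, rfl⟩ := hz
          obtain ⟨y', hy', rfl⟩ := hz'
          exact ⟨y + y', Submodule.add_mem _ hy hy', map_add _ _ _⟩
        | smul c z _ hz =>
          obtain ⟨y, hy, rfl⟩ := hz
          exact ⟨c • y, Submodule.smul_mem _ c hy, map_smul P (c : ℝ) y⟩
      obtain ⟨y, hy, hyx⟩ := hpull _ h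
      have hfy : f y ≤ 0 := (nonpos_of_mem_hull (by rintro _ ⟨k, hk, rfl⟩; exact hf k hk) hy).1
      rw [hPy, hPy] at hyx
      -- The coefficient is nonnegative because `f y ≤ 0 < f x` and `0 < f (a i)`.
      have hx : x = y + ((f x - f y) * (f (a i))⁻¹) • a i := by
        have h1 : x = y - (f y * (f (a i))⁻¹) • a i + (f x * (f (a i))⁻¹) • a i := by
          rw [hyx, sub_add_cancel]
        rw [sub_mul, sub_smul]
        exact h1.trans (by abel)
      have hai : a i ∈ PointedCone.hull ℝ (a '' (insert i t : Finset ι)) :=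
        Submodule.subset_span (Set.mem_image_of_mem a (by simp))
      rw [hx]
      refine Submodule.add_mem _ (hmono hy) (smul_mem_hull hai ?_)
      exact mul_nonneg (by linarith) (inv_nonneg.2 hfi.le)
    · refine Or.inr ⟨g ∘ₗ P, fun k hk => ?_, hgx⟩
      rcases Finset.mem_insert.1 hk with rfl | hk
      · simp [hPi]
      · exact hg k hk

lemma mem_hull_of_forall_nonpos {S : Set E} (hS : S.Finite) {x : E}
    (h : ∀ f : E →ₗ[ℝ] ℝ, (∀ s ∈ S, f s ≤ 0) → f x ≤ 0) : x ∈ PointedCone.hull ℝ S := by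
  rcases mem_hull_or_exists_separating hS.toFinset id x with h' | ⟨f, hf, hfx⟩
  · simpa using h'
  · exact absurd (h f fun s hs => hf s (by simpa using hs)) hfx.not_ge

lemma le_of_mem_convexHull {B : Set E} {f : E →ₗ[ℝ] ℝ} {M : ℝ} (hf : ∀ b ∈ B, f b ≤ M) {y : E}
    (hy : y ∈ convexHull ℝ B) :
    f y ≤ M ∧ (f y = M → y ∈ convexHull ℝ {b ∈ B | f b = M}) := by
  have hconv : Convex ℝ {y | f y ≤ M ∧ (f y = M → y ∈ convexHull ℝ {b ∈ B | f b = M})} := by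
    rintro x ⟨hx, hx'⟩ y ⟨hy, hy'⟩ a b ha hb hab
    have hfxy : f (a • x + b • y) = a * f x + b * f y := by simp
    have h1 : a * f x ≤ a * M := mul_le_mul_of_nonneg_left hx ha
    have h2 : b * f y ≤ b * M := mul_le_mul_of_nonneg_left hy hb
    have h3 : a * M + b * M = M := by rw [← add_mul, hab, one_mul]
    refine ⟨by rw [hfxy]; linarith, fun h => ?_⟩
    rw [hfxy] at h
    rcases ha.eq_or_lt with rfl | ha'
    · obtain rfl : b = 1 := by linarith
      simpa using hy' (by linarith)
    rcases hb.eq_or_lt with rfl | hb'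
    · obtain rfl : a = 1 := by linarith
      simpa using hx' (by linarith)
    exact convex_convexHull ℝ _ (hx' (mul_left_cancel₀ ha'.ne' (by linarith)))
      (hy' (mul_left_cancel₀ hb'.ne' (by linarith))) ha hb hab
  refine convexHull_min (fun b hb => ?_) hconv hy
  exact ⟨hf b hb, fun h => subset_convexHull ℝ {b ∈ B | f b = M} ⟨hb, h⟩⟩

end Convex

/-! ## Faces of brick polyhedra -/

section Faces

variable {n m : ℕ} {Q : Fin m → Fin n} {w : Equiv.Perm (Fin (n + 1))} {I J J' : Finset (Fin m)}
  {f : (Fin (n + 1) → ℝ) →ₗ[ℝ] ℝ}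

lemma IsFacet.exists_max (hJ : IsFacet Q w J) (hI : I ⊆ J) (f : (Fin (n + 1) → ℝ) →ₗ[ℝ] ℝ) :
    ∃ K, IsFacet Q w K ∧ I ⊆ K ∧
      ∀ J', IsFacet Q w J' → I ⊆ J' → f (brickVector Q J') ≤ f (brickVector Q K) := by
  classical
  obtain ⟨K, hK, hmax⟩ := Finset.exists_max_image
    (Finset.univ.filter fun J : Finset (Fin m) => IsFacet Q w J ∧ I ⊆ J)
    (fun J => f (brickVector Q J)) ⟨J, by simp [hJ, hI]⟩
  simp only [Finset.mem_filter, Finset.mem_univ, true_and] at hK hmax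
  exact ⟨K, hK.1, hK.2, fun J' h h' => hmax J' ⟨h, h'⟩⟩

/-- A functional that is nonpositive on the Bruhat cone is nonpositive on the roots of the facets
that maximize it. -/
lemma IsFacet.rootFunction_nonpos_of_max (hJ : IsFacet Q w J) (hI : I ⊆ J)
    (hf : ∀ β ∈ coverRoots Q w, f β ≤ 0)
    (hmax : ∀ J', IsFacet Q w J' → I ⊆ J' → f (brickVector Q J') ≤ f (brickVector Q J))
    {j : Fin m} (hj : j ∈ J) (hjI : j ∉ I) : f (rootFunction Q J j) ≤ 0 := by
  rcases hJ.flip_or_mem_coverRoots hj with ⟨J', hJ', hsub, c, hc, hb⟩ | h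
  · have := hmax J' hJ' (hsub I hI hjI)
    rw [hb, map_add, map_smul, smul_eq_mul] at this
    by_contra hcon
    have := mul_pos hc (not_le.1 hcon)
    linarith
  · exact hf _ h

lemma bruhatCone_eq (Q : Fin m → Fin n) (w : Equiv.Perm (Fin (n + 1))) :
    bruhatCone Q w = (PointedCone.hull ℝ (coverRoots Q w) : Set (Fin (n + 1) → ℝ)) := rfl

lemma finite_modifiedRootConfiguration (Q : Fin m → Fin n) (I J : Finset (Fin m)) :
    (modifiedRootConfiguration Q I J).Finite := by
  refine ((J \ I).finite_toSet.image (rootFunction Q J)).subset ?_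
  rintro β ⟨j, hj, rfl⟩
  exact ⟨j, hj, rfl⟩

/-- The Bruhat cone is contained in the cone of the roots of any facet. -/
lemma IsFacet.bruhatCone_subset (hJ : IsFacet Q w J) {x : Fin (n + 1) → ℝ}
    (hx : x ∈ bruhatCone Q w) : x ∈ PointedCone.hull ℝ (modifiedRootConfiguration Q ∅ J) := by
  refine mem_hull_of_forall_nonpos (finite_modifiedRootConfiguration Q ∅ J) fun g hg => ?_
  exact (nonpos_of_mem_hull (fun β hβ => hJ.coverRoots_nonpos
    (fun j hj => hg _ ⟨j, by simpa using hj, rfl⟩) hβ) hx).1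

/-- The modified Bruhat cone of a face is contained in the Bruhat cone. -/
lemma IsFacet.modifiedBruhatCone_subset (hJ : IsFacet Q w J) (hI : I ⊆ J)
    {x : Fin (n + 1) → ℝ} (hx : x ∈ modifiedBruhatCone Q w I) : x ∈ bruhatCone Q w := by
  rw [bruhatCone_eq]
  refine mem_hull_of_forall_nonpos (finite_coverRoots Q w) fun g hg => ?_
  -- The facet may depend on the functional: `x` lies in the root cones of all facets containing
  -- `I`, in particular of one maximizing `g`.
  obtain ⟨K, hK, hIK, hmax⟩ := hJ.exists_max hI g
  refine (nonpos_of_mem_hull ?_ (hx K hK hIK)).1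
  rintro _ ⟨j, hj, rfl⟩
  rw [Finset.mem_sdiff] at hj
  exact hK.rootFunction_nonpos_of_max hIK hg hmax hj.1 hj.2

/-- The part of the brick polyhedron where `f` has the value `M`, for `f` with maximum `M`. -/
def levelFace (Q : Fin m → Fin n) (w : Equiv.Perm (Fin (n + 1)))
    (f : (Fin (n + 1) → ℝ) →ₗ[ℝ] ℝ) (M : ℝ) : Set (Fin (n + 1) → ℝ) :=
  convexHull ℝ {b | ∃ J, IsFacet Q w J ∧ f (brickVector Q J) = M ∧ b = brickVector Q J} +
    {x | x ∈ bruhatCone Q w ∧ f x = 0}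

lemma map_eq_of_mem_levelFace {M : ℝ} {x : Fin (n + 1) → ℝ} (hx : x ∈ levelFace Q w f M) :
    f x = M := by
  obtain ⟨y, hy, c, ⟨-, hc⟩, rfl⟩ := hx
  have : convexHull ℝ {b | ∃ J, IsFacet Q w J ∧ f (brickVector Q J) = M ∧
      b = brickVector Q J} ⊆ {y | f y = M} := by
    refine convexHull_min ?_ (convex_hyperplane f.isLinear _)
    rintro _ ⟨J', -, h, rfl⟩
    exact h
  rw [map_add, hc, add_zero]
  exact this hy

lemma IsFacet.brickVector_add_mem_levelFace (hJ : IsFacet Q w J) {x : Fin (n + 1) → ℝ}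
    (hx : x ∈ bruhatCone Q w) (hfx : f x = 0) :
    brickVector Q J + x ∈ levelFace Q w f (f (brickVector Q J)) :=
  Set.add_mem_add (subset_convexHull ℝ _ ⟨J, hJ, rfl, rfl⟩) ⟨hx, hfx⟩

lemma zero_mem_bruhatCone (Q : Fin m → Fin n) (w : Equiv.Perm (Fin (n + 1))) :
    (0 : Fin (n + 1) → ℝ) ∈ bruhatCone Q w :=
  Submodule.zero_mem (PointedCone.hull ℝ (coverRoots Q w))

lemma IsFacet.brickVector_mem_levelFace_iff (hJ : IsFacet Q w J) {M : ℝ} :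
    brickVector Q J ∈ levelFace Q w f M ↔ f (brickVector Q J) = M := by
  refine ⟨map_eq_of_mem_levelFace, ?_⟩
  rintro rfl
  simpa using hJ.brickVector_add_mem_levelFace (zero_mem_bruhatCone Q w) (map_zero f)

/-- The roots of a facet that lie in the direction space of a face are those on which the
functional of the face vanishes. -/
lemma IsFacet.rootFunction_mem_directionSpace_iff (hJ : IsFacet Q w J) {j : Fin m} (hj : j ∈ J) :
    rootFunction Q J j ∈ directionSpace (levelFace Q w f (f (brickVector Q J))) ↔
      f (rootFunction Q J j) = 0 := by
  have hbJ := hJ.brickVector_mem_levelFace_iff.2 (rfl : f (brickVector Q J) = _)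
  constructor
  · intro h
    have hle : directionSpace (levelFace Q w f (f (brickVector Q J))) ≤ LinearMap.ker f := by
      refine Submodule.span_le.2 ?_
      rintro _ ⟨p, hp, q, hq, rfl⟩
      rw [SetLike.mem_coe, LinearMap.mem_ker, map_sub, map_eq_of_mem_levelFace hp,
        map_eq_of_mem_levelFace hq, sub_self]
    exact hle h
  · intro h
    -- A flip moves the brick vector along the root inside the face; a root that is a cover root is
    -- a direction of the cone part of the face.
    rcases hJ.flip_or_mem_coverRoots hj with ⟨J', hJ', -, c, hc, hb⟩ | hr
    · have hbJ' : brickVector Q J' ∈ levelFace Q w f (f (brickVector Q J)) := by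
        rw [hJ'.brickVector_mem_levelFace_iff, hb, map_add, map_smul, h, smul_zero, add_zero]
      have hr : rootFunction Q J j = c⁻¹ • (brickVector Q J' - brickVector Q J) := by
        rw [hb, add_sub_cancel_left, smul_smul, inv_mul_cancel₀ hc.ne', one_smul]
      rw [hr]
      exact Submodule.smul_mem _ _ (Submodule.subset_span ⟨_, hbJ', _, hbJ, rfl⟩)
    · refine Submodule.subset_span
        ⟨_, hJ.brickVector_add_mem_levelFace (Submodule.subset_span hr) h, _, hbJ, ?_⟩
      rw [add_sub_cancel_left]

lemma nonDirectionPositions_subset (Q : Fin m → Fin n) (F : Set (Fin (n + 1) → ℝ))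
    (J : Finset (Fin m)) : nonDirectionPositions Q F J ⊆ J := by
  classical exact Finset.filter_subset _ _

lemma mem_nonDirectionPositions (hJ : IsFacet Q w J) {j : Fin m} :
    j ∈ nonDirectionPositions Q (levelFace Q w f (f (brickVector Q J))) J ↔
      j ∈ J ∧ f (rootFunction Q J j) ≠ 0 := by
  simp only [nonDirectionPositions, Finset.mem_filter, and_congr_right_iff]
  exact fun hj => not_congr (hJ.rootFunction_mem_directionSpace_iff hj)

/-- The facets that contain the positions outside the direction space are those whose brick
vectors lie on the face. -/
lemma IsFacet.nonDirectionPositions_subset_iff (hJ : IsFacet Q w J)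
    (hf : ∀ β ∈ coverRoots Q w, f β ≤ 0)
    (hmax : ∀ J', IsFacet Q w J' → f (brickVector Q J') ≤ f (brickVector Q J))
    (hJ' : IsFacet Q w J') :
    nonDirectionPositions Q (levelFace Q w f (f (brickVector Q J))) J ⊆ J' ↔
      f (brickVector Q J') = f (brickVector Q J) := by
  constructor
  · intro hI'
    have hzero : ∀ j ∈ J, j ∉ nonDirectionPositions Q (levelFace Q w f (f (brickVector Q J))) J →
        f (rootFunction Q J j) = 0 := by
      intro j hj hjI
      by_contra hne
      exact hjI ((mem_nonDirectionPositions hJ).2 ⟨hj, hne⟩)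
    refine le_antisymm (hmax J' hJ') ?_
    -- `f` vanishes on the remaining roots of `J`, so `J` is locally optimal for `-f` too and
    -- minimizes `f` among the facets containing this set.
    have := hJ.brickVector_le (f := -f) hJ' (nonDirectionPositions_subset _ _ _) hI' fun j hj hjI => by
      simp [hzero j hj hjI]
    simpa using this
  · intro h j hj
    rw [mem_nonDirectionPositions hJ] at hj
    exact (hJ.rootFunction_eq_of_le (I := ∅) hJ' (Finset.empty_subset _) (Finset.empty_subset _)
      (fun j hj hjI => hJ.rootFunction_nonpos_of_max (Finset.empty_subset _) hf
        (fun J' h _ => hmax J' h) hj hjI) h.ge).2 j hj.1 hj.2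

lemma IsFacet.levelFace_eq (hJ : IsFacet Q w J) (hf : ∀ β ∈ coverRoots Q w, f β ≤ 0)
    (hmax : ∀ J', IsFacet Q w J' → f (brickVector Q J') ≤ f (brickVector Q J)) :
    levelFace Q w f (f (brickVector Q J)) = modifiedBrickPolyhedron Q w
      (nonDirectionPositions Q (levelFace Q w f (f (brickVector Q J))) J) := by
  set I := nonDirectionPositions Q (levelFace Q w f (f (brickVector Q J))) J with hI
  have hIJ : I ⊆ J := nonDirectionPositions_subset _ _ _
  have hiff : ∀ J', IsFacet Q w J' → (I ⊆ J' ↔ f (brickVector Q J') = f (brickVector Q J)) :=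
    fun J' hJ' => hJ.nonDirectionPositions_subset_iff hf hmax hJ'
  have hnonpos : ∀ j ∈ J, f (rootFunction Q J j) ≤ 0 := fun j hj =>
    hJ.rootFunction_nonpos_of_max (Finset.empty_subset _) hf (fun J' h _ => hmax J' h) hj (by simp)
  rw [modifiedBrickPolyhedron]
  conv_lhs => rw [levelFace]
  congr 1
  · congr 1
    ext b
    constructor
    · rintro ⟨J', hJ', h, rfl⟩
      exact ⟨J', hJ', (hiff J' hJ').2 h, rfl⟩
    · rintro ⟨J', hJ', h, rfl⟩
      exact ⟨J', hJ', (hiff J' hJ').1 h, rfl⟩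
  ext x
  constructor
  · rintro ⟨hx, hfx⟩ J' hJ' hIJ'
    have hr := (hJ.rootFunction_eq_of_le (I := ∅) hJ' (Finset.empty_subset _)
      (Finset.empty_subset _) (fun j hj _ => hnonpos j hj) ((hiff J' hJ').1 hIJ').ge).1
    have hnonpos' : ∀ j ∈ J', f (rootFunction Q J' j) ≤ 0 := fun j hj =>
      hJ'.rootFunction_nonpos_of_max (Finset.empty_subset _) hf
        (fun K h _ => (hmax K h).trans_eq ((hiff J' hJ').1 hIJ').symm) hj (by simp)
    -- As `f ≤ 0` on the roots of `J'` and `f x = 0`, only roots with `f = 0` are needed. Their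
    -- positions avoid `I`, since `J` and `J'` have the same `f`-values of roots.
    refine Submodule.span_mono ?_ ((nonpos_of_mem_hull (f := f) ?_ (hJ'.bruhatCone_subset hx)).2 hfx)
    · rintro _ ⟨⟨j, hj, rfl⟩, h⟩
      refine ⟨j, Finset.mem_sdiff.2 ⟨by simpa using hj, fun hjI => ?_⟩, rfl⟩
      exact ((mem_nonDirectionPositions hJ).1 hjI).2 ((hr j).symm.trans h)
    · rintro _ ⟨j, hj, rfl⟩
      exact hnonpos' j (by simpa using hj)
  · intro hx
    refine ⟨hJ.modifiedBruhatCone_subset hIJ hx, ?_⟩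
    have hzero : ∀ β ∈ modifiedRootConfiguration Q I J, f β = 0 := by
      rintro _ ⟨j, hj, rfl⟩
      rw [Finset.mem_sdiff] at hj
      by_contra hne
      exact hj.2 ((mem_nonDirectionPositions hJ).2 ⟨hj.1, hne⟩)
    have hx' := hx J hJ hIJ
    refine le_antisymm (nonpos_of_mem_hull (fun β hβ => (hzero β hβ).le) hx').1 ?_
    have := (nonpos_of_mem_hull (f := -f) (fun β hβ => by simp [hzero β hβ]) hx').1
    simpa using this

lemma exists_functional_of_isPolyhedronFace {F : Set (Fin (n + 1) → ℝ)}
    (hF : IsPolyhedronFace (brickPolyhedron Q w) F) :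
    ∃ (f : (Fin (n + 1) → ℝ) →ₗ[ℝ] ℝ) (J : Finset (Fin m)), IsFacet Q w J ∧
      (∀ β ∈ coverRoots Q w, f β ≤ 0) ∧
      (∀ J', IsFacet Q w J' → f (brickVector Q J') ≤ f (brickVector Q J)) ∧
      F = levelFace Q w f (f (brickVector Q J)) := by
  obtain ⟨hne, hexp⟩ := hF
  obtain ⟨l, hl⟩ := hexp hne
  obtain ⟨z, hz⟩ := hne
  have hz' := hz
  rw [hl] at hz'
  obtain ⟨hzP, hzmax⟩ := hz'
  set f : (Fin (n + 1) → ℝ) →ₗ[ℝ] ℝ := l.toLinearMap with hfdef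
  have hlf : ∀ x, l x = f x := fun _ => rfl
  simp only [hlf] at hl hzmax
  -- Adding a generator of the cone to a maximizer stays in the polyhedron.
  have hcone : ∀ β ∈ coverRoots Q w, f β ≤ 0 := by
    intro β hβ
    have hmem : z + β ∈ brickPolyhedron Q w := by
      obtain ⟨y, hy, c, hc, rfl⟩ := hzP
      rw [add_assoc]
      exact Set.add_mem_add hy (Submodule.add_mem (PointedCone.hull ℝ (coverRoots Q w)) hc
        (Submodule.subset_span hβ))
    have := hzmax _ hmem
    rw [map_add] at this
    linarith
  obtain ⟨J₀, hJ₀⟩ : ∃ J, IsFacet Q w J := by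
    obtain ⟨y, hy, -⟩ := hzP
    obtain ⟨_, J, hJ, -⟩ := convexHull_nonempty_iff.1 ⟨y, hy⟩
    exact ⟨J, hJ⟩
  obtain ⟨J, hJ, -, hmax⟩ := hJ₀.exists_max (Finset.empty_subset _) f
  have hmax' : ∀ J', IsFacet Q w J' → f (brickVector Q J') ≤ f (brickVector Q J) :=
    fun J' h => hmax J' h (Finset.empty_subset _)
  have hbd : ∀ b ∈ {b | ∃ J : Finset (Fin m), IsFacet Q w J ∧ b = brickVector Q J},
      f b ≤ f (brickVector Q J) := by
    rintro _ ⟨J', hJ', rfl⟩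
    exact hmax' J' hJ'
  have hJmem : brickVector Q J ∈ brickPolyhedron Q w :=
    ⟨_, subset_convexHull ℝ _ ⟨J, hJ, rfl⟩, 0, zero_mem_bruhatCone Q w, add_zero _⟩
  refine ⟨f, J, hJ, hcone, hmax', ?_⟩
  rw [hl]
  ext x
  constructor
  · rintro ⟨⟨y, hy, c, hc, rfl⟩, hx⟩
    have h1 := hx _ hJmem
    have h2 := le_of_mem_convexHull hbd hy
    have h3 := (nonpos_of_mem_hull hcone hc).1
    rw [map_add] at h1
    have h4 : f y = f (brickVector Q J) := by linarith [h2.1]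
    refine ⟨y, convexHull_mono ?_ (h2.2 h4), c, ⟨hc, by linarith [h2.1]⟩, rfl⟩
    rintro _ ⟨⟨J', hJ', rfl⟩, h⟩
    exact ⟨J', hJ', h, rfl⟩
  · intro hx
    have hfx := map_eq_of_mem_levelFace hx
    obtain ⟨y, hy, c, ⟨hc, -⟩, rfl⟩ := hx
    refine ⟨⟨y, convexHull_mono ?_ hy, c, hc, rfl⟩, ?_⟩
    · rintro _ ⟨J', hJ', -, rfl⟩
      exact ⟨J', hJ', rfl⟩
    · rintro _ ⟨y', hy', c', hc', rfl⟩
      rw [hfx, map_add]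
      linarith [(le_of_mem_convexHull hbd hy').1, (nonpos_of_mem_hull hcone hc').1]

end Faces

end BrickPolyhedra

end

theorem mainTheorem5 (n m : ℕ) (Q : Fin m → Fin n) (w : Equiv.Perm (Fin (n + 1)))
    (F : Set (Fin (n + 1) → ℝ))
    (hF : BrickPolyhedra.IsPolyhedronFace (BrickPolyhedra.brickPolyhedron Q w) F) :
    (∃ I : Finset (Fin m), BrickPolyhedra.IsFace Q w I ∧
      F = BrickPolyhedra.modifiedBrickPolyhedron Q w I) ∧
    (∀ J : Finset (Fin m), BrickPolyhedra.IsFacet Q w J → BrickPolyhedra.brickVector Q J ∈ F →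
      F = BrickPolyhedra.modifiedBrickPolyhedron Q w
          (BrickPolyhedra.nonDirectionPositions Q F J) ∧
      ∀ J' : Finset (Fin m), BrickPolyhedra.IsFacet Q w J' →
        (BrickPolyhedra.nonDirectionPositions Q F J ⊆ J' ↔
          BrickPolyhedra.brickVector Q J' ∈ F)) := by
  obtain ⟨f, J₀, hJ₀, hcone, hmax, hFeq⟩ :=
    BrickPolyhedra.exists_functional_of_isPolyhedronFace hF
  have hmain : ∀ J : Finset (Fin m), BrickPolyhedra.IsFacet Q w J →
      BrickPolyhedra.brickVector Q J ∈ F →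
      F = BrickPolyhedra.modifiedBrickPolyhedron Q w
          (BrickPolyhedra.nonDirectionPositions Q F J) ∧
      ∀ J' : Finset (Fin m), BrickPolyhedra.IsFacet Q w J' →
        (BrickPolyhedra.nonDirectionPositions Q F J ⊆ J' ↔
          BrickPolyhedra.brickVector Q J' ∈ F) := by
    intro J hJ hJF
    rw [hFeq, hJ.brickVector_mem_levelFace_iff] at hJF
    -- Any facet with brick vector on `F` attains the same maximum, so it can take the place of
    -- `J₀`.
    rw [← hJF] at hFeq hmax
    rw [hFeq]
    exact ⟨hJ.levelFace_eq hcone hmax, fun J' hJ' =>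
      (hJ.nonDirectionPositions_subset_iff hcone hmax hJ').trans
        hJ'.brickVector_mem_levelFace_iff.symm⟩
  have hmem : BrickPolyhedra.brickVector Q J₀ ∈ F := by
    rw [hFeq, hJ₀.brickVector_mem_levelFace_iff]
  exact ⟨⟨_, ⟨J₀, hJ₀, BrickPolyhedra.nonDirectionPositions_subset _ _ _⟩, (hmain J₀ hJ₀ hmem).1⟩, hmain⟩
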